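/- Let $n\ge 1$, $H>0$, $\epsilon=\pm1$, and let $\mathbb R^{n+2}$, with coordinates $y^0,\dots,y^{n+1}$, carry the metric $\eta=\mathrm{diag}(+,-,\dots,-,-\epsilon,\epsilon)$, which has signature $(2,n)$. Let $P=\{f=1\}$ with $f(y)=Hy^{n+1}$, and let $\Sigma_n$ be the intersection of $P$ with the null cone $\eta(y,y)=0$, with the induced metric (de Sitter space for $\epsilon=1$, anti-de Sitter space for $\epsilon=-1$). Let $m:\Sigma_n\to\mathbb R^{n+2}$ be the inclusion, and let $D_P=\sum_{A=0}^{n}y^A\partial_A$ be the dilation field of $P$. For a pseudo-Riemannian metric in dimension $d$, let $\square=-(d\delta+\delta d)$ be the Laplace–de Rham operator, where $\delta=*^{-1}d*\hat\eta$, $\hat\eta=(-1)^p$ on $p$-forms, and $*$ is the Hodge operator, $\beta\wedge *\alpha=(\beta,\alpha)\,\mathrm{vol}$. Write $\square_{n+2}$ and $\square_\Sigma$ for the operators of $(\mathbb R^{n+2},\eta)$ and of $\Sigma_n$. Let $e_0,\dots,e_{n-1}$ be a smooth field of orthonormal frames of $\Sigma_n$ on an open subset $V\subset\Sigma_n$,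 with $\eta(e_\mu,e_\nu)=\eta_{\mu\nu}$. Complete it by $e_n=D_P/\sqrt{|y_P^2|}$, where $y_P^2=\sum_{A=0}^n\eta_{AA}(y^A)^2$, and by $e_{n+1}=\partial_{n+1}$. Extend the components of the $e_\mu$ off $V$ so that they are homogeneous of degree $0$ in $(y^0,\dots,y^n)$ and independent of $y^{n+1}$; $(e_0,\dots,e_{n+1})$ is assumed positively oriented. Let $(e^\alpha)$ be the dual coframe. Then for every smooth one-form $a$ on an open set $\Omega\subset\mathbb R^{n+2}$ (for instance $\Omega=\mathbb R^{n+2}$), with $a_\mu=a(e_\mu)$, one has on $V\cap\Omega$ $$m^*(\square_{n+2}a)=\square_\Sigma (m^*a)+m^*\Bigl[\epsilon\sum_{\mu=0}^{n-1}(\partial_{n+1}^2a_\mu)\,e^\mu-\epsilon H^2\bigl(\mathcal L_{D_P}^2a+(n-3)\mathcal L_{D_P}a+2\,d(i_{D_P}a)\bigr)\Bigr].$$ -/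

import Mathlib

open scoped ContDiff

noncomputable section

namespace LaplaceRestriction

/-! ### Differential forms on open subsets of a coordinate space -/

/-- The coordinate space `ℝ^N`. -/
abbrev Coord (N : ℕ) : Type := Fin N → ℝ

/-- Differential forms of degree `p` on (subsets of) `ℝ^N`. -/
abbrev Form (N p : ℕ) : Type := Coord N → Coord N [⋀^Fin p]→L[ℝ] ℝ

/-- The coordinate vector field `∂_i`. -/
def partialVec {N : ℕ} (i : Fin N) : Coord N := Pi.single i 1

/-- Interior product `i_X α`. -/
def interior {N p : ℕ} (X : Coord N → Coord N) (α : Form N (p + 1)) : Form N p :=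
  fun y => (α y).curryLeft (X y)

/-- Lie derivative `L_X α = i_X dα + d (i_X α)` of a form of positive degree. -/
def lieDerivative {N p : ℕ} (X : Coord N → Coord N) (α : Form N (p + 1)) : Form N (p + 1) :=
  fun y => interior X (extDeriv α) y + extDeriv (interior X α) y

/-- Pullback `φ^* α` of a form by a map. -/
def pullback {N M p : ℕ} (φ : Coord M → Coord N) (α : Form N p) : Form M p :=
  fun u => (α (φ u)).compContinuousLinearMap (fderiv ℝ φ u)

/-! ### Hodge operator, codifferential, and Laplace-de Rham operator of a pseudo-metric

A pseudo-Riemannian metric on an open subset of `ℝ^N` is given by its matrix field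
`g x i j = g_x(∂_i, ∂_j)`; the orientation is the one of the coordinates.
-/

/-- The standard determinant form `dx^1 ∧ ⋯ ∧ dx^N`. -/
def detForm (N : ℕ) : Coord N [⋀^Fin N]→L[ℝ] ℝ :=
  { (Matrix.detRowAlternating : Coord N [⋀^Fin N]→ₗ[ℝ] ℝ) with
    cont := Continuous.matrix_det (A := fun v : Fin N → Coord N => Matrix.of v) continuous_id }

/-- The metric volume form `√|det g| dx^1 ∧ ⋯ ∧ dx^N` at a point, `G` being the matrix of the
metric at that point. -/
def volumeForm {N : ℕ} (G : Matrix (Fin N) (Fin N) ℝ) : Coord N [⋀^Fin N]→L[ℝ] ℝ :=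
  √|G.det| • detForm N

/-- The vector `♯ dx^i = g^{ij} ∂_j` at a point. -/
def sharpBasis {N : ℕ} (G : Matrix (Fin N) (Fin N) ℝ) (i : Fin N) : Coord N :=
  fun j => G⁻¹ i j

/-- Contraction of the first `p` slots: `τ (v 0, …, v (p - 1), ⋯)`. -/
def contractFirst {N : ℕ} (q : ℕ) : (p : ℕ) → (Fin p → Coord N) →
    (Coord N [⋀^Fin (q + p)]→L[ℝ] ℝ) → (Coord N [⋀^Fin q]→L[ℝ] ℝ)
  | 0, _, τ => τ
  | p + 1, v, τ => contractFirst q p (Fin.tail v) (ContinuousAlternatingMap.curryLeft τ (v 0))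

/-- Reindexing of the slots along an equality of degrees. -/
def castDegree {N p q : ℕ} (h : p = q) (τ : Coord N [⋀^Fin p]→L[ℝ] ℝ) :
    Coord N [⋀^Fin q]→L[ℝ] ℝ :=
  { τ.toAlternatingMap.domDomCongr (finCongr h) with
    cont := τ.cont.comp (continuous_pi fun i => continuous_apply (finCongr h i)) }

/-- Hodge operator from `p`-forms to `q`-forms at a point, `p + q = N`:
`(∗α)(w) = (1/p!) α^{i_1 … i_p} vol(∂_{i_1}, …, ∂_{i_p}, w)`, that is, the operator with
`β ∧ ∗α = (β, α)_g vol` for all `p`-forms `β`. -/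
def hodgeStar {N p q : ℕ} (h : N = q + p) (G : Matrix (Fin N) (Fin N) ℝ)
    (α : Coord N [⋀^Fin p]→L[ℝ] ℝ) : Coord N [⋀^Fin q]→L[ℝ] ℝ :=
  ((p.factorial : ℝ)⁻¹) • ∑ I : Fin p → Fin N,
    α (fun k => sharpBasis G (I k)) •
      contractFirst q p (fun k => partialVec (I k))
        (castDegree h (volumeForm G))

/-- The inverse Hodge operator `∗⁻¹ = sgn(g) ∗ η̂^{N+1}` on `p`-forms, where `η̂` multiplies
`p`-forms by `(-1)^p`. -/
def hodgeStarInv {N p q : ℕ} (h : N = q + p) (G : Matrix (Fin N) (Fin N) ℝ)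
    (α : Coord N [⋀^Fin p]→L[ℝ] ℝ) : Coord N [⋀^Fin q]→L[ℝ] ℝ :=
  (Real.sign G.det * (-1) ^ (p * (N + 1))) • hodgeStar h G α

/-- The codifferential `δ = ∗⁻¹ d ∗ η̂` on forms of degree `p + 1`. Forms of degree larger than
the dimension vanish, and so does their codifferential. -/
def codiff {N p : ℕ} (g : Coord N → Matrix (Fin N) (Fin N) ℝ) (α : Form N (p + 1)) : Form N p :=
  if h : p + 1 ≤ N then
    fun x => hodgeStarInv (p := N - (p + 1) + 1) (q := p) (by omega) (g x)
      (extDeriv (fun z => hodgeStar (p := p + 1) (q := N - (p + 1)) (by omega) (g z)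
        ((-1 : ℝ) ^ (p + 1) • α z)) x)
  else 0

/-- The Laplace-de Rham operator `□ = -(dδ + δd)` on forms of positive degree. -/
def laplaceDeRham {N p : ℕ} (g : Coord N → Matrix (Fin N) (Fin N) ℝ) (α : Form N (p + 1)) :
    Form N (p + 1) :=
  fun x => -(extDeriv (codiff g α) x + codiff g (extDeriv α) x)

/-! ### The ambient space `ℝ^{n+2}` and the (anti-)de Sitter space `Σ_n` -/

/-- The diagonal entries of `η = diag(+, -, …, -, -ε, ε)` on `ℝ^{n+2}`. -/
def etaDiag (n : ℕ) (ε : ℝ) (α : Fin (n + 2)) : ℝ :=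
  if α = Fin.last (n + 1) then ε
  else if α = (Fin.last n).castSucc then -ε
  else if α = 0 then 1
  else -1

/-- The constant ambient metric as a matrix field. -/
def ambientMetric (n : ℕ) (ε : ℝ) : Coord (n + 2) → Matrix (Fin (n + 2)) (Fin (n + 2)) ℝ :=
  fun _ => Matrix.diagonal (etaDiag n ε)

/-- The bilinear form `η(v, w)`. -/
def eta (n : ℕ) (ε : ℝ) (v w : Coord (n + 2)) : ℝ := ∑ α, etaDiag n ε α * v α * w α

/-- `Σ_n`: the intersection of the null cone `η(y, y) = 0` with the hyperplane
`P = {f = 1}`, `f(y) = H y^{n+1}`. -/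
def SigmaSet (n : ℕ) (ε H : ℝ) : Set (Coord (n + 2)) :=
  {y | eta n ε y y = 0 ∧ H * y (Fin.last (n + 1)) = 1}

/-- The tangent space of `Σ_n` at `y`: the common kernel of the differentials at `y` of the two
defining functions. -/
def TangentTo (n : ℕ) (ε : ℝ) (y v : Coord (n + 2)) : Prop :=
  eta n ε y v = 0 ∧ v (Fin.last (n + 1)) = 0

/-- The dilation field `D_P = y^A ∂_A`, `A = 0, …, n`, of the hyperplane `P`. -/
def dilationP (n : ℕ) (y : Coord (n + 2)) : Coord (n + 2) :=
  fun α => if α = Fin.last (n + 1) then 0 else y α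

/-- `√|y_P²|`, where `y_P² = y^A y_A`, `A = 0, …, n`. -/
def normP (n : ℕ) (ε : ℝ) (y : Coord (n + 2)) : ℝ :=
  √|eta n ε (dilationP n y) (dilationP n y)|

/-- The point of `Σ_n` below `y`: project along `∂_{n+1}` onto `P`, then along the half-lines of
`P` issued from its origin onto `Σ_n`. -/
def toSigma (n : ℕ) (ε H : ℝ) (y : Coord (n + 2)) : Coord (n + 2) :=
  fun α => if α = Fin.last (n + 1) then H⁻¹ else H⁻¹ * (normP n ε y)⁻¹ * y α

/-- The frame of `ℝ^{n+2}` built from a frame `e_0, …, e_{n-1}` of `Σ_n`: add the outer unit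
normal `e_n = D_P / √|y_P²|` of `Σ_n` in `P` and `e_{n+1} = ∂_{n+1}`, and extend all
components homogeneously of degree `0` along the half-lines of `P` and constantly
along `∂_{n+1}`. -/
def extendedFrame (n : ℕ) (ε H : ℝ) (e : Fin n → Coord (n + 2) → Coord (n + 2))
    (y : Coord (n + 2)) : Fin (n + 2) → Coord (n + 2) :=
  Fin.snoc (α := fun _ => Coord (n + 2))
    (Fin.snoc (α := fun _ => Coord (n + 2)) (fun μ => e μ (toSigma n ε H y))
      ((normP n ε y)⁻¹ • dilationP n y))
    (partialVec (Fin.last (n + 1)))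

/-- `e_0, …, e_{n-1}` is a smooth field of positively oriented orthonormal frames of `Σ_n` on the
relatively open subset `V` of `Σ_n`. -/
structure IsOrthonormalFrame (n : ℕ) (ε H : ℝ) (V : Set (Coord (n + 2)))
    (e : Fin n → Coord (n + 2) → Coord (n + 2)) : Prop where
  relOpen : ∃ O : Set (Coord (n + 2)), IsOpen O ∧ V = SigmaSet n ε H ∩ O
  smooth : ∀ μ, ContDiffOn ℝ ∞ (e μ) V
  tangent : ∀ y ∈ V, ∀ μ, TangentTo n ε y (e μ y)
  orthonormal : ∀ y ∈ V, ∀ μ ν, eta n ε (e μ y) (e ν y) =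
    if μ = ν then etaDiag n ε μ.castSucc.castSucc else 0
  oriented : ∀ y ∈ V, 0 < (Matrix.of (extendedFrame n ε H e y)).det

/-- The coframe `e^α` dual to the extended frame, as one-forms. -/
def coframe (n : ℕ) (ε H : ℝ) (e : Fin n → Coord (n + 2) → Coord (n + 2)) (α : Fin (n + 2)) :
    Form (n + 2) 1 :=
  fun y => ContinuousAlternatingMap.ofSubsingleton ℝ (Coord (n + 2)) ℝ (0 : Fin 1)
    (LinearMap.toContinuousLinearMap
      ((LinearMap.proj α).comp
        (Matrix.vecMulLinear (Matrix.of (extendedFrame n ε H e y))⁻¹)))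

/-- The frame component `a_α = a(e_α)` of a one-form. -/
def frameComponent (n : ℕ) (ε H : ℝ) (e : Fin n → Coord (n + 2) → Coord (n + 2))
    (a : Form (n + 2) 1) (α : Fin (n + 2)) (y : Coord (n + 2)) : ℝ :=
  a y (fun _ => extendedFrame n ε H e y α)

/-- The partial derivative `∂_{n+1} h`. -/
def partialLast (n : ℕ) (h : Coord (n + 2) → ℝ) (y : Coord (n + 2)) : ℝ :=
  lineDeriv ℝ h y (partialVec (Fin.last (n + 1)))

/-- The one-form `(∂²_{n+1} a_μ) e^μ`, summed over `μ = 0, …, n - 1`. -/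
def secondVerticalTerm (n : ℕ) (ε H : ℝ) (e : Fin n → Coord (n + 2) → Coord (n + 2))
    (a : Form (n + 2) 1) : Form (n + 2) 1 :=
  fun y => ∑ μ : Fin n,
    partialLast n (partialLast n (frameComponent n ε H e a μ.castSucc.castSucc)) y •
      coframe n ε H e μ.castSucc.castSucc y

/-- `φ : U → Σ_n` is a smooth local parametrization of `Σ_n` (a smooth immersion of an open subset
of `ℝ^n` into the `n`-dimensional `Σ_n`, hence locally the inverse of a chart). -/
structure IsLocalParametrization (n : ℕ) (ε H : ℝ) (U : Set (Coord n))
    (φ : Coord n → Coord (n + 2)) : Prop where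
  isOpen : IsOpen U
  smooth : ContDiffOn ℝ ∞ φ U
  immersion : ∀ u ∈ U, Function.Injective (fderiv ℝ φ u)
  mapsTo : Set.MapsTo φ U (SigmaSet n ε H)

/-- The metric of `Σ_n` induced by the ambient one, in the parametrization `φ`:
`g_{ij} = η(∂_i φ, ∂_j φ)`. -/
def inducedMetric (n : ℕ) (ε : ℝ) (φ : Coord n → Coord (n + 2)) :
    Coord n → Matrix (Fin n) (Fin n) ℝ :=
  fun u => Matrix.of fun i j =>
    eta n ε (fderiv ℝ φ u (partialVec i)) (fderiv ℝ φ u (partialVec j))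

end LaplaceRestriction

end

noncomputable section

namespace LaplaceRestriction

/-! ### Alternating functions of multi-indices -/

/-! Two facts carry the proof: the codifferential is minus a divergence, and the extrinsic geometry
of Σ_n is that of a pseudo-sphere in P with normal D_P.

Unwinding the Hodge operators gives (δα)^K = -|g|^{-1/2} ∂_i(|g|^{1/2} α^{iK}) for any nondegenerate
metric (`codiff_apply_sharp`). In the ambient space this makes □ act on each component as η^{αα}∂_α²
(`laplaceDeRham_ambient_apply`).

On Σ_n write E_i = ∂_iφ and E^i = g^{ij}E_j, kept as vectors of the ambient space, and let A be the
one-form a seen as a field of functionals. The contravariant components of the pulled-back a and da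
are A(E^i) and da(E^i, E^k), so each divergence is a product rule. Three inputs evaluate it: the
trace Σ E_i⊗E^i = η^{-1} + εH² D_P⊗D_P - ε ∂_{n+1}⊗∂_{n+1} (`sum_tangent_trace`); the mean curvature
vector nεH² D_P (`sum_fderiv_density_raisedVec`); and the fact that in da(E^i, ∂_iE^k) the
Christoffel part dies by antisymmetry, leaving the normal part εH² da(E_j, D_P) once the index is
lowered (`sum_alternating_fderiv_raisedVec`). The codifferential of the pulled-back a is then minus
the restriction of an ambient function, so its differential follows from the chain rule.

Adding the dδ and δd halves, the mixed second derivatives cancel. What remains beyond the flat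
operator is -ε∂²_{n+1}A, the term εH² ∂²A(D_P, D_P), and first- and zeroth-order terms in D_P.
Expanding the Lie derivatives of a along the linear field D_P gives exactly these terms. The
orthonormal frame enters only through Σ e^μ(v) e_μ = v for tangent v (`sum_coframe`). -/

/-- A function of `q` indices that is alternating under permutations of the slots. -/
def IsAltIndex {q N : ℕ} (f : (Fin q → Fin N) → ℝ) : Prop :=
  ∀ (I : Fin q → Fin N) (σ : Equiv.Perm (Fin q)), f (I ∘ σ) = (Equiv.Perm.sign σ : ℤ) * f I

theorem sign_mul_self_cast {q : ℕ} (σ : Equiv.Perm (Fin q)) :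
    ((Equiv.Perm.sign σ : ℤ) : ℝ) * (Equiv.Perm.sign σ : ℤ) = 1 := by
  rcases Int.units_eq_one_or (Equiv.Perm.sign σ) with h | h <;> simp [h]

theorem IsAltIndex.eq_zero {q N : ℕ} {f : (Fin q → Fin N) → ℝ} (hf : IsAltIndex f)
    {I : Fin q → Fin N} (hI : ¬ Function.Injective I) : f I = 0 := by
  obtain ⟨i, j, hij, hne⟩ : ∃ i j, I i = I j ∧ i ≠ j := by
    simpa [Function.Injective] using hI
  have h := hf I (Equiv.swap i j)
  have hIs : I ∘ Equiv.swap i j = I := by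
    funext k
    by_cases h1 : k = i
    · subst h1; simp [hij]
    by_cases h2 : k = j
    · subst h2; simp [hij]
    simp [Equiv.swap_apply_of_ne_of_ne h1 h2]
  rw [hIs, Equiv.Perm.sign_swap hne] at h
  push_cast at h
  linarith

theorem IsAltIndex.insertNth {q N : ℕ} {f : (Fin (q + 1) → Fin N) → ℝ} (hf : IsAltIndex f)
    (k : Fin (q + 1)) (i : Fin N) (J : Fin q → Fin N) :
    f (k.insertNth (α := fun _ => Fin N) i J) =
      (-1) ^ (k : ℕ) * f (Fin.cons (α := fun _ => Fin N) i J) := by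
  have h := hf (Fin.cons (α := fun _ => Fin N) i J) k.cycleRange
  rw [Fin.cons_comp_cycleRange, Fin.sign_cycleRange] at h
  rw [h]
  push_cast
  rfl

theorem IsAltIndex.sum {ι : Type*} {q N : ℕ} (s : Finset ι) {f : ι → (Fin q → Fin N) → ℝ}
    (hf : ∀ i, IsAltIndex (f i)) : IsAltIndex (fun J => ∑ i ∈ s, f i J) := by
  intro I σ
  simp only [hf _ I σ, Finset.mul_sum]

theorem IsAltIndex.const_mul {q N : ℕ} (c : ℝ) {f : (Fin q → Fin N) → ℝ}
    (hf : IsAltIndex f) : IsAltIndex (fun J => c * f J) := by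
  intro I σ
  simp only [hf I σ]
  ring

/-- A sum of products of alternating functions concentrated on the rearrangements of one
injective multi-index. -/
theorem sum_mul_of_isAltIndex {q N : ℕ} {f g : (Fin q → Fin N) → ℝ} (hf : IsAltIndex f)
    (hg : IsAltIndex g) {C : Fin q → Fin N} (hC : Function.Injective C)
    (hz : ∀ J, (∀ σ : Equiv.Perm (Fin q), J ≠ C ∘ σ) → f J * g J = 0) :
    ∑ J, f J * g J = q.factorial * (f C * g C) := by
  classical
  have hinj : Function.Injective (fun σ : Equiv.Perm (Fin q) => C ∘ σ) := by
    intro σ τ h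
    ext k
    exact congrArg Fin.val (hC (congrFun h k))
  rw [← Finset.sum_subset (Finset.subset_univ (Finset.univ.image
    (fun σ : Equiv.Perm (Fin q) => C ∘ σ)))]
  · rw [Finset.sum_image hinj.injOn]
    have : ∀ σ : Equiv.Perm (Fin q), f (C ∘ σ) * g (C ∘ σ) = f C * g C := by
      intro σ
      rw [hf, hg]
      calc _ = (((Equiv.Perm.sign σ : ℤ) : ℝ) * (Equiv.Perm.sign σ : ℤ)) * (f C * g C) := by ring
        _ = _ := by rw [sign_mul_self_cast, one_mul]
    simp [this, Fintype.card_perm]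
  · intro J _ hJ
    refine hz J fun σ h => hJ ?_
    simp [h]

/-- Contraction of the exterior derivative pattern with an alternating function. -/
theorem sum_alternate_mul {q N : ℕ} (t : Fin N → (Fin q → Fin N) → ℝ)
    {γ : (Fin (q + 1) → Fin N) → ℝ} (hγ : IsAltIndex γ) :
    ∑ L : Fin (q + 1) → Fin N,
        (∑ k : Fin (q + 1), (-1) ^ (k : ℕ) * t (L k) (k.removeNth L)) * γ L =
      (q + 1) * ∑ i, ∑ J, t i J * γ (Fin.cons (α := fun _ => Fin N) i J) := by
  simp only [Finset.sum_mul]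
  rw [Finset.sum_comm]
  have : ∀ k : Fin (q + 1), ∑ L : Fin (q + 1) → Fin N,
      (-1 : ℝ) ^ (k : ℕ) * t (L k) (k.removeNth L) * γ L =
      ∑ i, ∑ J, t i J * γ (Fin.cons (α := fun _ => Fin N) i J) := by
    intro k
    -- Summing over the k-th index and the others separately, all q + 1 values of k contribute
    -- equally: bringing the k-th index to the front of γ costs the sign (-1)^k already present.
    rw [← (Fin.insertNthEquiv (fun _ => Fin N) k).sum_comp, Fintype.sum_prod_type]
    refine Finset.sum_congr rfl fun i _ => Finset.sum_congr rfl fun J _ => ?_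
    have h1 : ((-1 : ℝ) ^ (k : ℕ)) * (-1) ^ (k : ℕ) = 1 := by
      rw [← mul_pow]; simp
    have e : Fin.insertNthEquiv (fun _ => Fin N) k (i, J) = k.insertNth i J := rfl
    rw [e, Fin.insertNth_apply_same, Fin.removeNth_insertNth, hγ.insertNth]
    linear_combination (t i J * γ (Fin.cons (α := fun _ => Fin N) i J)) * h1
  simp [this]

/-! ### Juxtaposed tuples and the Levi-Civita symbol -/

/-- The tuple `(v, w)` of length `N = q + p`. -/
def joinTuple {X : Type*} {N p q : ℕ} (h : N = q + p) (v : Fin p → X) (w : Fin q → X) :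
    Fin N → X :=
  fun k => Fin.append v w (Fin.cast (h.trans (Nat.add_comm q p)) k)

/-- The Levi-Civita symbol. -/
def leviCivita {N : ℕ} (L : Fin N → Fin N) : ℝ := detForm N (fun k => partialVec (L k))

theorem detForm_apply {N : ℕ} (v : Fin N → Coord N) : detForm N v = (Matrix.of v).det := rfl

theorem detForm_comp_perm {N : ℕ} (v : Fin N → Coord N) (σ : Equiv.Perm (Fin N)) :
    detForm N (v ∘ σ) = (Equiv.Perm.sign σ : ℤ) * detForm N v := by
  rw [detForm_apply, detForm_apply, ← Matrix.det_permute]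
  rfl

theorem leviCivita_comp_perm {N : ℕ} (L : Fin N → Fin N) (σ : Equiv.Perm (Fin N)) :
    leviCivita (L ∘ σ) = (Equiv.Perm.sign σ : ℤ) * leviCivita L :=
  detForm_comp_perm (fun k => partialVec (L k)) σ

theorem leviCivita_eq_zero {N : ℕ} {L : Fin N → Fin N} (hL : ¬ Function.Injective L) :
    leviCivita L = 0 :=
  IsAltIndex.eq_zero (f := leviCivita) leviCivita_comp_perm hL

theorem leviCivita_mul_self {N : ℕ} {L : Fin N → Fin N} (hL : Function.Injective L) :
    leviCivita L * leviCivita L = 1 := by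
  let σ : Equiv.Perm (Fin N) := Equiv.ofBijective L (Finite.injective_iff_bijective.1 hL)
  have h1 : leviCivita (id : Fin N → Fin N) = 1 := by
    rw [leviCivita, detForm_apply, ← Matrix.det_one (n := Fin N) (R := ℝ)]
    congr 1
    ext i j
    simp [partialVec, Matrix.one_apply, Pi.single_apply, eq_comm]
  have h2 : leviCivita L = (Equiv.Perm.sign σ : ℤ) := by
    have := leviCivita_comp_perm id σ
    rw [h1, mul_one] at this
    exact this
  rw [h2, sign_mul_self_cast]

theorem joinTuple_comp {X Y : Type*} {N p q : ℕ} (h : N = q + p) (f : X → Y) (v : Fin p → X)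
    (w : Fin q → X) (k : Fin N) :
    joinTuple h (fun i => f (v i)) (fun i => f (w i)) k = f (joinTuple h v w k) := by
  unfold joinTuple
  generalize Fin.cast _ k = l
  induction l using Fin.addCases <;> simp

theorem finRotate_pow_val {N : ℕ} (m : ℕ) (k : Fin (N + 1)) :
    ((finRotate (N + 1) ^ m) k : ℕ) = (k + m) % (N + 1) := by
  induction m with
  | zero => simp [Nat.mod_eq_of_lt k.2]
  | succ m ih =>
    rw [pow_succ', Equiv.Perm.mul_apply, finRotate_apply, Fin.val_add, ih]
    rw [Fin.val_one', ← Nat.add_mod, add_assoc]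

/-- Exchanging the two blocks of a juxtaposed tuple. -/
theorem detForm_joinTuple_swap {N p q : ℕ} (h : N = q + p) (h' : N = p + q)
    (v : Fin p → Coord N) (w : Fin q → Coord N) :
    detForm N (joinTuple h v w) = (-1) ^ (p * q) * detForm N (joinTuple h' w v) := by
  obtain _ | m := N
  · have hp : p = 0 := by omega
    have hq : q = 0 := by omega
    subst hp hq
    rw [show joinTuple h v w = joinTuple h' w v from funext fun k => k.elim0]
    simp
  -- The block exchange is the q-th power of the cyclic rotation of m + 1 points, whose sign is
  -- (-1)^m.
  · have key : joinTuple h v w = joinTuple h' w v ∘ (finRotate (m + 1) ^ q) := by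
      funext k
      simp only [joinTuple, Function.comp_apply, Fin.append, Fin.addCases]
      have hk := finRotate_pow_val q k
      have := k.2
      by_cases hkp : (k : ℕ) < p
      · have e : ((finRotate (m + 1) ^ q) k : ℕ) = k + q := by
          rw [hk, Nat.mod_eq_of_lt (by omega)]
        simp [hkp, e, Fin.subNat, Fin.castLT]
      · have e : ((finRotate (m + 1) ^ q) k : ℕ) = k - p := by
          rw [hk, show (k : ℕ) + q = (k - p) + (m + 1) by omega, Nat.add_mod_right,
            Nat.mod_eq_of_lt (by omega)]
        have : (k : ℕ) - p < q := by omega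
        simp [hkp, e, Fin.subNat, Fin.castLT, this]
    rw [key, detForm_comp_perm, map_pow, sign_finRotate]
    congr 1
    push_cast
    rw [← pow_mul]
    rcases q with _ | q
    · simp
    -- Here q + 1 is the block length, so the exponent is (p + q)(q + 1) = p(q + 1) + q(q + 1), and
    -- the second summand is even.
    · rw [show m = p + q by omega, add_mul, pow_add,
        (Nat.even_mul_succ_self q).neg_one_pow, mul_one]

theorem isAltIndex_form {M N q : ℕ} (τ : Coord M [⋀^Fin q]→L[ℝ] ℝ) (v : Fin N → Coord M) :
    IsAltIndex (fun J : Fin q → Fin N => τ (fun k => v (J k))) := by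
  intro J σ
  have := τ.toAlternatingMap.map_perm (fun k => v (J k)) σ
  simp only [Units.smul_def, zsmul_eq_mul] at this
  exact this

theorem castDegree_apply {N p q : ℕ} (h : p = q) (τ : Coord N [⋀^Fin p]→L[ℝ] ℝ)
    (v : Fin q → Coord N) : castDegree h τ v = τ (fun k => v (Fin.cast h k)) := rfl

theorem contractFirst_apply {N : ℕ} (q : ℕ) : ∀ (p : ℕ) (v : Fin p → Coord N)
    (τ : Coord N [⋀^Fin (q + p)]→L[ℝ] ℝ) (w : Fin q → Coord N),
    contractFirst q p v τ w = τ (joinTuple rfl v w)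
  | 0, v, τ, w => by
    simp only [contractFirst]
    congr 1
    funext k
    simp [joinTuple, Fin.append, Fin.addCases, Fin.subNat]
  | p + 1, v, τ, w => by
    rw [contractFirst, contractFirst_apply q p]
    change τ (Fin.cons (v 0) _) = _
    congr 1
    funext k
    refine Fin.cases ?_ (fun k => ?_) k
    · simp [joinTuple, Fin.append, Fin.addCases, Fin.castLT]
    · simp only [Fin.cons_succ, joinTuple, Fin.append, Fin.addCases]
      by_cases hk : (k : ℕ) < p
      · simp [hk, Fin.tail, Fin.castLT]
      · simp [hk, Fin.subNat]

theorem contractFirst_castDegree_apply {N p q : ℕ} (h : N = q + p) (v : Fin p → Coord N)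
    (τ : Coord N [⋀^Fin N]→L[ℝ] ℝ) (w : Fin q → Coord N) :
    contractFirst q p v (castDegree h τ) w = τ (joinTuple h v w) := by
  rw [contractFirst_apply, castDegree_apply]
  rfl

theorem detForm_joinTuple_partialVec {N p q : ℕ} (h : N = q + p) (I : Fin p → Fin N)
    (J : Fin q → Fin N) :
    detForm N (joinTuple h (fun k => partialVec (I k)) (fun k => partialVec (J k))) =
      leviCivita (joinTuple h I J) := by
  rw [leviCivita]
  congr 1
  funext k
  exact joinTuple_comp h partialVec I J k

theorem isAltIndex_leviCivita_right {N p q : ℕ} (h : N = q + p) (I : Fin p → Fin N) :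
    IsAltIndex (fun J : Fin q → Fin N => leviCivita (joinTuple h I J)) := by
  have := isAltIndex_form (contractFirst q p (fun k => partialVec (I k))
    (castDegree h (detForm N))) (partialVec (N := N))
  simpa only [contractFirst_castDegree_apply, detForm_joinTuple_partialVec] using this

theorem leviCivita_joinTuple_swap {N p q : ℕ} (h : N = q + p) (h' : N = p + q)
    (I : Fin p → Fin N) (J : Fin q → Fin N) :
    leviCivita (joinTuple h I J) = (-1) ^ (p * q) * leviCivita (joinTuple h' J I) := by
  rw [← detForm_joinTuple_partialVec, ← detForm_joinTuple_partialVec, detForm_joinTuple_swap h h']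

theorem isAltIndex_leviCivita_left {N p q : ℕ} (h : N = q + p) (J : Fin q → Fin N) :
    IsAltIndex (fun I : Fin p → Fin N => leviCivita (joinTuple h I J)) := by
  have h' : N = p + q := by omega
  simp only [leviCivita_joinTuple_swap h h']
  exact (isAltIndex_leviCivita_right h' J).const_mul _

theorem joinTuple_injective_iff {X : Type*} {N p q : ℕ} (h : N = q + p) (v : Fin p → X)
    (w : Fin q → X) : Function.Injective (joinTuple h v w) ↔
      Function.Injective v ∧ Function.Injective w ∧ ∀ i j, v i ≠ w j := by
  have : joinTuple h v w = Fin.append v w ∘ finCongr (h.trans (Nat.add_comm q p)) := rfl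
  rw [this, (finCongr _).injective_comp, Fin.append_injective_iff]

/-- Two injective multi-indices with disjoint complementary ranges: anything disjoint from one is
a rearrangement of the other. -/
theorem exists_perm_of_disjoint {N p q : ℕ} (h : N = q + p) {K : Fin p → Fin N}
    {C J : Fin q → Fin N} (hKC : Function.Injective (joinTuple h K C))
    (hKJ : Function.Injective (joinTuple h K J)) :
    ∃ σ : Equiv.Perm (Fin q), J = C ∘ σ := by
  have hsurj : Function.Surjective (joinTuple h K C) := Finite.surjective_of_injective hKC
  rw [joinTuple_injective_iff] at hKJ
  have : ∀ k, ∃ m, C m = J k := by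
    intro k
    obtain ⟨l, hl⟩ := hsurj (J k)
    unfold joinTuple at hl
    revert hl
    generalize Fin.cast _ l = l
    induction l using Fin.addCases with
    | left i => intro hl; exact absurd (by simpa using hl) (hKJ.2.2 i k)
    | right i => intro hl; exact ⟨i, by simpa using hl⟩
  choose s hs using this
  have hsi : Function.Injective s := by
    intro a b hab
    apply hKJ.2.1
    rw [← hs, ← hs, hab]
  exact ⟨Equiv.ofBijective s (Finite.injective_iff_bijective.1 hsi), funext fun k => (hs k).symm⟩

theorem exists_complement {N p q : ℕ} (h : N = q + p) {K : Fin p → Fin N}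
    (hK : Function.Injective K) : ∃ C : Fin q → Fin N, Function.Injective (joinTuple h K C) := by
  classical
  have hcard : (Finset.univ.image K)ᶜ.card = q := by
    rw [Finset.card_compl, Finset.card_image_of_injective _ hK]
    simp; omega
  refine ⟨(Finset.univ.image K)ᶜ.orderEmbOfFin hcard, ?_⟩
  rw [joinTuple_injective_iff]
  refine ⟨hK, ((Finset.univ.image K)ᶜ.orderEmbOfFin hcard).injective, fun i j hij => ?_⟩
  have := Finset.orderEmbOfFin_mem (Finset.univ.image K)ᶜ hcard j
  rw [← hij] at this
  simp at this

/-- The square of the Euclidean Hodge operator, on components. -/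
theorem sum_leviCivita_leviCivita {N p q : ℕ} (h : N = q + p) (h' : N = p + q)
    {b : (Fin p → Fin N) → ℝ} (hb : IsAltIndex b) (K : Fin p → Fin N) :
    ∑ J : Fin q → Fin N, (∑ I, b I * leviCivita (joinTuple h I J)) *
        leviCivita (joinTuple h' J K) =
      p.factorial * q.factorial * (-1) ^ (p * q) * b K := by
  by_cases hK : Function.Injective K
  · obtain ⟨C, hC⟩ := exists_complement h hK
    have hC' : Function.Injective (joinTuple h' C K) := by
      rw [joinTuple_injective_iff] at hC ⊢
      exact ⟨hC.2.1, hC.1, fun i j => (hC.2.2 j i).symm⟩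
    have hCi := ((joinTuple_injective_iff _ _ _).1 hC).2.1
    -- With C complementary to K, the outer sum lives on the q! rearrangements of C and, for J = C,
    -- the inner one on the p! rearrangements of K.
    have e1 := sum_mul_of_isAltIndex
      (f := fun J => ∑ I, b I * leviCivita (joinTuple h I J))
      (g := fun J => leviCivita (joinTuple h' J K))
      (IsAltIndex.sum _ fun I => (isAltIndex_leviCivita_right h I).const_mul _)
      (isAltIndex_leviCivita_left h' K) hCi (fun J hJ => by
        rw [leviCivita_eq_zero (fun hi => ?_), mul_zero]
        rw [joinTuple_injective_iff] at hi
        obtain ⟨σ, hσ⟩ := exists_perm_of_disjoint h hC ((joinTuple_injective_iff _ _ _).2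
          ⟨hi.2.1, hi.1, fun i j => (hi.2.2 j i).symm⟩)
        exact hJ σ hσ)
    have e2 := sum_mul_of_isAltIndex (f := b) (g := fun I => leviCivita (joinTuple h I C)) hb
      (isAltIndex_leviCivita_left h C) hK (fun J hJ => by
        rw [leviCivita_eq_zero (fun hi => ?_), mul_zero]
        rw [joinTuple_injective_iff] at hi
        obtain ⟨σ, hσ⟩ := exists_perm_of_disjoint h' hC' ((joinTuple_injective_iff _ _ _).2
          ⟨hi.2.1, hi.1, fun i j => (hi.2.2 j i).symm⟩)
        exact hJ σ hσ)
    have e3 := leviCivita_joinTuple_swap h' h C K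
    have e4 := leviCivita_mul_self hC
    rw [e1]
    simp only [e2]
    rw [e3, mul_comm q p]
    linear_combination (p.factorial * q.factorial * (-1) ^ (p * q) * b K) * e4
  · rw [hb.eq_zero hK, mul_zero]
    refine Finset.sum_eq_zero fun J _ => ?_
    rw [leviCivita_eq_zero (fun hi => hK ((joinTuple_injective_iff _ _ _).1 hi).2.1), mul_zero]

/-- The index i is moved past the q entries of J. As the last entry of the left block it is, after
reassociation, the first entry of the right block. -/
theorem leviCivita_joinTuple_cons {N p q : ℕ} (h : N = p + (q + 1)) (h' : N = (p + 1) + q)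
    (i : Fin N) (J : Fin q → Fin N) (K : Fin p → Fin N) :
    leviCivita (joinTuple h (Fin.cons (α := fun _ => Fin N) i J) K) =
      (-1) ^ q * leviCivita (joinTuple h' J (Fin.cons (α := fun _ => Fin N) i K)) := by
  have h1 := (isAltIndex_leviCivita_left h K).insertNth (Fin.last q) i J
  have h2 : ((-1 : ℝ) ^ q) * (-1) ^ q = 1 := by rw [← mul_pow]; simp
  have h3 : joinTuple h ((Fin.last q).insertNth (α := fun _ => Fin N) i J) K =
      joinTuple h' J (Fin.cons (α := fun _ => Fin N) i K) := by
    funext k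
    simp only [joinTuple, Fin.insertNth_last']
    rw [Fin.append_right_cons, Fin.append_left_snoc]
    rfl
  rw [h3, Fin.val_last] at h1
  rw [h1, ← mul_assoc, h2, one_mul]

/-- Transferring a symmetric matrix from one multilinear map to the other inside a full
contraction. -/
theorem sum_multilinear_symm {N p : ℕ} {S : Matrix (Fin N) (Fin N) ℝ} (hS : S.IsSymm)
    (f g : MultilinearMap ℝ (fun _ : Fin p => Coord N) ℝ) :
    ∑ I : Fin p → Fin N, f (fun k => S (I k)) * g (fun k => partialVec (I k)) =
      ∑ I : Fin p → Fin N, f (fun k => partialVec (I k)) * g (fun k => S (I k)) := by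
  classical
  have expand : ∀ (f : MultilinearMap ℝ (fun _ : Fin p => Coord N) ℝ) (I : Fin p → Fin N),
      f (fun k => S (I k)) =
        ∑ L : Fin p → Fin N, (∏ k, S (I k) (L k)) * f (fun k => partialVec (L k)) := by
    intro f I
    have : (fun k => S (I k)) = fun k => ∑ l, S (I k) l • (partialVec l : Coord N) := by
      funext k j
      simp [partialVec, Pi.single_apply]
    rw [this, MultilinearMap.map_sum]
    refine Finset.sum_congr rfl fun L _ => ?_
    rw [MultilinearMap.map_smul_univ, smul_eq_mul]
  simp only [expand, Finset.sum_mul, Finset.mul_sum]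
  rw [Finset.sum_comm]
  refine Finset.sum_congr rfl fun L _ => Finset.sum_congr rfl fun I _ => ?_
  rw [Finset.prod_congr rfl fun k _ => hS.apply (L k) (I k)]
  ring

/-! ### The codifferential as a divergence -/

theorem hodgeStar_apply {N p q : ℕ} (h : N = q + p) (G : Matrix (Fin N) (Fin N) ℝ)
    (α : Coord N [⋀^Fin p]→L[ℝ] ℝ) (w : Fin q → Coord N) :
    hodgeStar h G α w = (p.factorial : ℝ)⁻¹ * ∑ I : Fin p → Fin N,
      α (fun k => sharpBasis G (I k)) *
        (√|G.det| * detForm N (joinTuple h (fun k => partialVec (I k)) w)) := by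
  simp only [hodgeStar, ContinuousAlternatingMap.smul_apply, ContinuousAlternatingMap.sum_apply,
    contractFirst_castDegree_apply, volumeForm, smul_eq_mul]

theorem detForm_rows {N : ℕ} (S : Matrix (Fin N) (Fin N) ℝ) (M : Fin N → Fin N) :
    detForm N (fun k => S (M k)) = S.det * leviCivita M := by
  rw [leviCivita, detForm_apply, detForm_apply, mul_comm, ← Matrix.det_mul]
  congr 1
  ext i j
  simp [Matrix.mul_apply, partialVec, Pi.single_apply]

/-- By symmetry of S the contraction can be moved from β to the determinant. There S acts on all N
slots and comes out as its determinant. -/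
theorem sum_sharp_detForm {N p q : ℕ} (h : N = p + q) {S : Matrix (Fin N) (Fin N) ℝ}
    (hS : S.IsSymm) (β : Coord N [⋀^Fin q]→L[ℝ] ℝ) (K : Fin p → Fin N) :
    ∑ L : Fin q → Fin N, β (fun k => S (L k)) *
        detForm N (joinTuple h (fun k => partialVec (L k)) (fun k => S (K k))) =
      S.det * ∑ L : Fin q → Fin N, β (fun k => partialVec (L k)) *
        leviCivita (joinTuple h L K) := by
  have h' : N = q + p := by omega
  have e := sum_multilinear_symm hS β.toMultilinearMap
    (contractFirst q p (fun k => S (K k)) (castDegree h' (detForm N))).toMultilinearMap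
  simp only [ContinuousMultilinearMap.coe_coe, ContinuousAlternatingMap.coe_toContinuousMultilinearMap,
    contractFirst_castDegree_apply] at e
  simp only [detForm_joinTuple_swap h h']
  calc _ = (-1) ^ (q * p) * ∑ L : Fin q → Fin N, β (fun k => S (L k)) *
        detForm N (joinTuple h' (fun k => S (K k)) (fun k => partialVec (L k))) := by
        rw [Finset.mul_sum]
        exact Finset.sum_congr rfl fun L _ => by ring
    _ = _ := by
      rw [e, Finset.mul_sum, Finset.mul_sum]
      refine Finset.sum_congr rfl fun L _ => ?_
      have e1 : joinTuple h' (fun k => S (K k)) (fun k => S (L k)) =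
        fun k => S (joinTuple h' K L k) := funext fun k => joinTuple_comp h' S K L k
      rw [e1, detForm_rows, leviCivita_joinTuple_swap h h']
      ring

/-- The densitized contravariant components `√|det g| α^I`. -/
def densitized {N p : ℕ} (g : Coord N → Matrix (Fin N) (Fin N) ℝ) (α : Form N p)
    (I : Fin p → Fin N) (z : Coord N) : ℝ :=
  √|(g z).det| * α z (fun k => sharpBasis (g z) (I k))

theorem densitized_comp_perm {N p : ℕ} (g : Coord N → Matrix (Fin N) (Fin N) ℝ) (α : Form N p)
    (I : Fin p → Fin N) (σ : Equiv.Perm (Fin p)) :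
    densitized g α (I ∘ σ) = fun z => ((Equiv.Perm.sign σ : ℤ) : ℝ) * densitized g α I z := by
  funext z
  have := isAltIndex_form (α z) (sharpBasis (g z)) I σ
  simp only [] at this
  simp only [densitized]
  rw [this]
  ring

theorem isAltIndex_fderiv_densitized {N p : ℕ} {g : Coord N → Matrix (Fin N) (Fin N) ℝ}
    {α : Form N p} {x : Coord N} (hc : ∀ I, DifferentiableAt ℝ (densitized g α I) x)
    (v : Coord N) : IsAltIndex (fun I => fderiv ℝ (densitized g α I) x v) := by
  intro I σ
  simp only []
  rw [densitized_comp_perm, fderiv_const_mul (hc I)]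
  rfl

/-- The inner star is a sum of densitized components times constant forms, so d differentiates only
those components. The outer star contributes a second Levi-Civita symbol, and the double contraction
collapses by `sum_leviCivita_leviCivita`. What remains is bookkeeping of factorials, signs and
powers of the determinant. -/
theorem codiff_aux {N p q : ℕ} (h1 : N = q + (p + 1)) (h2 : N = p + (q + 1))
    {g : Coord N → Matrix (Fin N) (Fin N) ℝ} {α : Form N (p + 1)} {x : Coord N}
    (hdet : (g x).det ≠ 0) (hsymm : (g x).IsSymm)
    (hc : ∀ I, DifferentiableAt ℝ (densitized g α I) x) (K : Fin p → Fin N) :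
    hodgeStarInv h2 (g x) (extDeriv (fun z => hodgeStar h1 (g z) ((-1 : ℝ) ^ (p + 1) • α z)) x)
        (fun k => sharpBasis (g x) (K k)) =
      -(√|(g x).det|)⁻¹ * ∑ i, fderiv ℝ
        (densitized g α (Fin.cons (α := fun _ => Fin N) i K)) x (partialVec i) := by
  set θ : Form N q := fun z => hodgeStar h1 (g z) ((-1 : ℝ) ^ (p + 1) • α z) with hθ
  -- The factorial comes from the inner Hodge operator, the sign from η̂.
  set r : ℝ := ((p + 1).factorial : ℝ)⁻¹ * (-1) ^ (p + 1) with hr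
  have hθsum : θ = fun z => ∑ I : Fin (p + 1) → Fin N, (r * densitized g α I z) •
      contractFirst q (p + 1) (fun k => partialVec (I k)) (castDegree h1 (detForm N)) := by
    funext z
    ext w
    simp only [hθ, hodgeStar_apply, ContinuousAlternatingMap.sum_apply,
      ContinuousAlternatingMap.smul_apply, contractFirst_castDegree_apply, smul_eq_mul,
      Finset.mul_sum, densitized, hr]
    exact Finset.sum_congr rfl fun I _ => by ring
  have hθd : DifferentiableAt ℝ θ x := by
    rw [hθsum]
    exact DifferentiableAt.fun_sum fun I _ => ((hc I).const_mul r).smul_const _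
  have hθJ : ∀ (J : Fin q → Fin N) (v : Coord N),
      fderiv ℝ (fun z => θ z (fun k => partialVec (J k))) x v =
        r * ∑ I, fderiv ℝ (densitized g α I) x v * leviCivita (joinTuple h1 I J) := by
    intro J v
    have : (fun z => θ z (fun k => partialVec (J k))) = fun z =>
        ∑ I, densitized g α I z * (r * leviCivita (joinTuple h1 I J)) := by
      funext z
      simp only [hθsum, ContinuousAlternatingMap.sum_apply,
        ContinuousAlternatingMap.smul_apply, contractFirst_castDegree_apply, smul_eq_mul,
        detForm_joinTuple_partialVec]
      exact Finset.sum_congr rfl fun I _ => by ring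
    rw [this, fderiv_fun_sum fun I _ => (hc I).mul_const _, _root_.sum_apply,
      Finset.mul_sum]
    refine Finset.sum_congr rfl fun I _ => ?_
    rw [fderiv_mul_const (hc I)]
    simp only [_root_.smul_apply, smul_eq_mul]
    ring
  have hβ : ∀ L : Fin (q + 1) → Fin N, extDeriv θ x (fun k => partialVec (L k)) =
      ∑ k : Fin (q + 1), (-1) ^ (k : ℕ) *
        (r * ∑ I, fderiv ℝ (densitized g α I) x (partialVec (L k)) *
          leviCivita (joinTuple h1 I (k.removeNth L))) := by
    intro L
    rw [extDeriv_apply hθd]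
    refine Finset.sum_congr rfl fun k _ => ?_
    rw [← hθJ, zsmul_eq_mul]
    push_cast
    rfl
  have h3 : N = (p + 1) + q := by omega
  have key : ∑ L : Fin (q + 1) → Fin N, extDeriv θ x (fun k => partialVec (L k)) *
      leviCivita (joinTuple h2 L K) = (q + 1).factorial * (-1) ^ (p * q + p + 1) *
        ∑ i, fderiv ℝ (densitized g α (Fin.cons (α := fun _ => Fin N) i K)) x (partialVec i) := by
    simp only [hβ]
    rw [sum_alternate_mul (fun i J => r * ∑ I, fderiv ℝ (densitized g α I) x (partialVec i) *
      leviCivita (joinTuple h1 I J)) (isAltIndex_leviCivita_left h2 K), Finset.mul_sum,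
      Finset.mul_sum]
    refine Finset.sum_congr rfl fun i _ => ?_
    simp only [leviCivita_joinTuple_cons h2 h3]
    have e := sum_leviCivita_leviCivita h1 h3
      (isAltIndex_fderiv_densitized hc (partialVec i)) (Fin.cons (α := fun _ => Fin N) i K)
    have e2 : ∀ J : Fin q → Fin N,
        (r * ∑ I, fderiv ℝ (densitized g α I) x (partialVec i) *
          leviCivita (joinTuple h1 I J)) *
        ((-1) ^ q * leviCivita (joinTuple h3 J (Fin.cons (α := fun _ => Fin N) i K))) =
        (r * (-1) ^ q) * ((∑ I, fderiv ℝ (densitized g α I) x (partialVec i) *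
          leviCivita (joinTuple h1 I J)) *
          leviCivita (joinTuple h3 J (Fin.cons (α := fun _ => Fin N) i K))) := fun J => by ring
    simp only [e2]
    rw [← Finset.mul_sum, e, hr, Nat.factorial_succ q]
    have hp : ((p + 1).factorial : ℝ) ≠ 0 := by positivity
    have hs : ((-1 : ℝ) ^ q) * (-1) ^ q = 1 := by rw [← mul_pow]; simp
    push_cast
    field_simp
    rw [add_mul, one_mul, pow_add, pow_add, pow_add, pow_add]
    linear_combination -(fderiv ℝ (densitized g α (Fin.cons (α := fun _ => Fin N) i K)) x
      (partialVec i) * (-1) ^ p * (-1) ^ (p * q)) * hs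
  -- The sign is that of ∗⁻¹, the inverse determinant comes from raising indices, and the root from
  -- the outer volume form.
  have hsgn : Real.sign (g x).det * ((g x)⁻¹).det * √|(g x).det| = (√|(g x).det|)⁻¹ := by
    have hpos : 0 < |(g x).det| := abs_pos.2 hdet
    have hsq := Real.mul_self_sqrt hpos.le
    have hi : Real.sign (g x).det * ((g x)⁻¹).det * |(g x).det| = 1 := by
      rw [Matrix.det_nonsing_inv, Ring.inverse_eq_inv']
      rcases lt_or_gt_of_ne hdet with hd | hd
      · rw [Real.sign_of_neg hd, abs_of_neg hd]; field_simp
      · rw [Real.sign_of_pos hd, abs_of_pos hd]; field_simp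
    exact eq_inv_of_mul_eq_one_left (by rw [mul_assoc, hsq, hi])
  have hSsymm : ((g x)⁻¹).IsSymm := by
    rw [Matrix.IsSymm, Matrix.transpose_nonsing_inv, hsymm.eq]
  have e3 := sum_sharp_detForm h2 hSsymm (extDeriv θ x) K
  rw [key] at e3
  rw [hodgeStarInv, ContinuousAlternatingMap.smul_apply, hodgeStar_apply, smul_eq_mul]
  have e4 : ∑ I : Fin (q + 1) → Fin N, extDeriv θ x (fun k => sharpBasis (g x) (I k)) *
      (√|(g x).det| * detForm N (joinTuple h2 (fun k => partialVec (I k))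
        fun k => sharpBasis (g x) (K k))) = √|(g x).det| *
      ∑ L : Fin (q + 1) → Fin N, extDeriv θ x (fun k => (g x)⁻¹ (L k)) *
        detForm N (joinTuple h2 (fun k => partialVec (L k)) (fun k => (g x)⁻¹ (K k))) := by
    rw [Finset.mul_sum]
    exact Finset.sum_congr rfl fun I _ => mul_left_comm _ _ _
  rw [e4, e3]
  have hf : ((q + 1).factorial : ℝ) ≠ 0 := by positivity
  -- Since N = p + q + 1, the total exponent is q(q + 1) + 2(pq + p + q + 1) + 1, which is odd.
  have hpar : (-1 : ℝ) ^ ((q + 1) * (N + 1)) * (-1) ^ (p * q + p + 1) = -1 := by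
    rw [← pow_add]
    apply Odd.neg_one_pow
    obtain ⟨c, hc⟩ := Nat.even_mul_succ_self q
    refine ⟨c + p * q + q + p + 1, ?_⟩
    rw [h2]
    nlinarith
  rw [← hsgn]
  field_simp
  linear_combination (Real.sign (g x).det * ((g x)⁻¹).det * ∑ i, fderiv ℝ
        (densitized g α (Fin.cons (α := fun _ => Fin N) i K)) x (partialVec i)) * hpar

theorem form_eq_zero_of_lt {N p : ℕ} (h : N < p) (τ : Coord N [⋀^Fin p]→L[ℝ] ℝ) : τ = 0 := by
  ext v
  refine τ.toAlternatingMap.map_linearDependent v fun hv => ?_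
  have := hv.fintype_card_le_finrank
  simp at this
  omega

/-- The codifferential is minus the covariant divergence:
`(δα)^K = -|g|^{-1/2} ∂_i (|g|^{1/2} α^{iK})`. -/
theorem codiff_apply_sharp {N p : ℕ}
    {g : Coord N → Matrix (Fin N) (Fin N) ℝ} {α : Form N (p + 1)} {x : Coord N}
    (hdet : (g x).det ≠ 0) (hsymm : (g x).IsSymm)
    (hc : ∀ I, DifferentiableAt ℝ (densitized g α I) x) (K : Fin p → Fin N) :
    codiff g α x (fun k => sharpBasis (g x) (K k)) =
      -(√|(g x).det|)⁻¹ * ∑ i, fderiv ℝ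
        (densitized g α (Fin.cons (α := fun _ => Fin N) i K)) x (partialVec i) := by
  by_cases h : p + 1 ≤ N
  · rw [codiff, dif_pos h]
    exact codiff_aux _ _ hdet hsymm hc K
  -- Above the top degree the form vanishes and `codiff` is zero by definition, so both sides are 0.
  · have h0 : ∀ I, densitized g α I = fun _ => 0 := fun I => funext fun z => by
      rw [densitized, form_eq_zero_of_lt (by omega) (α z)]
      simp
    rw [codiff, dif_neg h]
    simp [h0]

/-! ### Calculus of determinants and inverse matrices -/

/-- The determinant is multilinear in the rows. Replacing row i by its derivative is Cramer's
expression, which the adjugate computes. -/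
theorem hasFDerivAt_det {N M : ℕ} {G : Coord M → Matrix (Fin N) (Fin N) ℝ} {x : Coord M}
    (hG : ∀ i j, DifferentiableAt ℝ (fun z => G z i j) x) :
    ∃ D : Coord M →L[ℝ] ℝ, HasFDerivAt (fun z => (G z).det) D x ∧ ∀ v, D v =
      ∑ i, ∑ j, (G x).adjugate j i * fderiv ℝ (fun z => G z i j) x v := by
  have hrow : HasFDerivAt (fun z => (fun i j => G z i j : Fin N → Coord N))
      (ContinuousLinearMap.pi fun i => ContinuousLinearMap.pi fun j =>
        fderiv ℝ (fun z => G z i j) x) x :=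
    hasFDerivAt_pi.2 fun i => hasFDerivAt_pi.2 fun j => (hG i j).hasFDerivAt
  have h := ((detForm N).toContinuousMultilinearMap.hasFDerivAt
    (fun i j => G x i j : Fin N → Coord N)).comp x hrow
  refine ⟨_, h, fun v => ?_⟩
  rw [ContinuousLinearMap.comp_apply, ContinuousMultilinearMap.linearDeriv_apply]
  refine Finset.sum_congr rfl fun i _ => ?_
  have e := congrFun (Matrix.cramer_eq_adjugate_mulVec (G x).transpose
    (fun j => fderiv ℝ (fun z => G z i j) x v)) i
  rw [Matrix.cramer_transpose_apply, ← Matrix.adjugate_transpose] at e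
  exact e

theorem differentiableAt_det {N M : ℕ} {G : Coord M → Matrix (Fin N) (Fin N) ℝ} {x : Coord M}
    (hG : ∀ i j, DifferentiableAt ℝ (fun z => G z i j) x) :
    DifferentiableAt ℝ (fun z => (G z).det) x := by
  obtain ⟨D, hD, -⟩ := hasFDerivAt_det hG
  exact hD.differentiableAt

theorem adjugate_eq_det_smul_inv {N : ℕ} {G : Matrix (Fin N) (Fin N) ℝ} (hG : G.det ≠ 0) :
    G.adjugate = G.det • G⁻¹ := by
  rw [Matrix.inv_def, Ring.inverse_eq_inv', smul_smul, mul_inv_cancel₀ hG, one_smul]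

/-- An entry of the inverse is a quotient of two determinants, so differentiability reduces to that
of the determinant. -/
theorem differentiableAt_inv_apply {N M : ℕ} {G : Coord M → Matrix (Fin N) (Fin N) ℝ}
    {x : Coord M} (hG : ∀ i j, DifferentiableAt ℝ (fun z => G z i j) x) (hdet : (G x).det ≠ 0)
    (k l : Fin N) : DifferentiableAt ℝ (fun z => (G z)⁻¹ k l) x := by
  have : (fun z => (G z)⁻¹ k l) = fun z =>
      ((G z).det)⁻¹ * ((G z).updateRow l (Pi.single k 1)).det := by
    funext z
    rw [Matrix.inv_def, Ring.inverse_eq_inv', Matrix.smul_apply, Matrix.adjugate_apply, smul_eq_mul]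
  rw [this]
  refine ((differentiableAt_det hG).inv hdet).mul (differentiableAt_det fun i j => ?_)
  by_cases hi : i = l
  · simp [hi]
  · simpa [Matrix.updateRow_ne hi] using hG i j

/-- Jacobi's formula for the metric density. -/
theorem hasFDerivAt_sqrt_abs_det {N M : ℕ} {G : Coord M → Matrix (Fin N) (Fin N) ℝ}
    {x : Coord M} (hG : ∀ i j, DifferentiableAt ℝ (fun z => G z i j) x) (hdet : (G x).det ≠ 0) :
    ∃ D : Coord M →L[ℝ] ℝ, HasFDerivAt (fun z => √|(G z).det|) D x ∧ ∀ v, D v =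
      √|(G x).det| * (2⁻¹ * ∑ i, ∑ j, (G x)⁻¹ j i * fderiv ℝ (fun z => G z i j) x v) := by
  obtain ⟨D, hD, hDv⟩ := hasFDerivAt_det hG
  have hpos : 0 < |(G x).det| := abs_pos.2 hdet
  have h1 := (hasDerivAt_abs hdet).comp_hasFDerivAt x hD
  have h2 := h1.sqrt hpos.ne'
  refine ⟨_, h2, fun v => ?_⟩
  have hs : 0 < √|(G x).det| := Real.sqrt_pos.2 hpos
  have hsq := Real.mul_self_sqrt hpos.le
  -- The sign produced by differentiating the absolute value is absorbed by the determinant factor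
  -- of the adjugate.
  have hsd : ((SignType.sign (G x).det : SignType) : ℝ) * (G x).det = |(G x).det| :=
    sign_mul_self _
  simp only [_root_.smul_apply, smul_eq_mul, hDv, adjugate_eq_det_smul_inv hdet,
    Matrix.smul_apply, Function.comp_apply, mul_assoc]
  simp only [← Finset.mul_sum]
  generalize ∑ i, ∑ j, (G x)⁻¹ j i * fderiv ℝ (fun z => G z i j) x v = t
  field_simp
  rw [pow_two, hsq, ← hsd]

/-! ### Forms of low degree -/

theorem extDeriv_zeroForm_apply {N : ℕ} (β : Form N 0) (x : Coord N) (v : Fin 1 → Coord N) :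
    extDeriv β x v = fderiv ℝ (fun z => β z Fin.elim0) x (v 0) := by
  have : β = fun z => ContinuousAlternatingMap.constOfIsEmpty ℝ (Coord N) (Fin 0)
      (β z Fin.elim0) := by
    funext z
    ext w
    rw [ContinuousAlternatingMap.constOfIsEmpty_apply, Subsingleton.elim w Fin.elim0]
  conv_lhs => rw [this]
  rw [extDeriv_constOfIsEmpty]
  rfl

/-- A one-form as a field of linear functionals. -/
def toLinear {N : ℕ} (a : Form N 1) (y : Coord N) : Coord N →L[ℝ] ℝ :=
  (ContinuousAlternatingMap.ofSubsingletonLIE (𝕜 := ℝ) (E := Coord N)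
    (F := ℝ) (0 : Fin 1)).symm (a y)

theorem toLinear_apply {N : ℕ} (a : Form N 1) (y v : Coord N) :
    toLinear a y v = a y (fun _ => v) := by
  rfl

theorem form_one_apply {N : ℕ} (a : Form N 1) (y : Coord N) (v : Fin 1 → Coord N) :
    a y v = toLinear a y (v 0) := by
  rw [toLinear_apply]
  congr 1
  funext k
  rw [Subsingleton.elim k 0]

theorem contDiffAt_toLinear {N : ℕ} {a : Form N 1} {y : Coord N} {m : WithTop ℕ∞}
    (ha : ContDiffAt ℝ m a y) : ContDiffAt ℝ m (toLinear a) y :=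
  ((ContinuousAlternatingMap.ofSubsingletonLIE (𝕜 := ℝ) (E := Coord N)
    (F := ℝ) (0 : Fin 1)).symm.contDiff.contDiffAt).comp y ha

theorem fderiv_form_one_apply {N : ℕ} (a : Form N 1) (y : Coord N) (w v : Coord N) :
    fderiv ℝ (toLinear a) y v w = fderiv ℝ a y v (fun _ => w) := by
  have : toLinear a = (ContinuousAlternatingMap.ofSubsingletonLIE (𝕜 := ℝ) (E := Coord N)
    (F := ℝ) (0 : Fin 1)).symm ∘ a := rfl
  rw [this, LinearIsometryEquiv.comp_fderiv]
  rfl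

theorem extDeriv_one_apply {N : ℕ} (a : Form N 1) (y : Coord N) (v : Fin 2 → Coord N) : extDeriv a y v =
      fderiv ℝ (toLinear a) y (v 0) (v 1) - fderiv ℝ (toLinear a) y (v 1) (v 0) := by
  rw [extDeriv, ContinuousAlternatingMap.alternatizeUncurryFin_apply, Fin.sum_univ_two,
    fderiv_form_one_apply, fderiv_form_one_apply]
  have h0 : Fin.removeNth 0 v = fun _ => v 1 := by
    funext k; rw [Subsingleton.elim k 0]; rfl
  have h1 : Fin.removeNth 1 v = fun _ => v 0 := by
    funext k; rw [Subsingleton.elim k 0]; rfl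
  rw [h0, h1]
  simp
  ring

/-! ### The Laplace-de Rham operator of the ambient space -/

theorem minSmoothness_two_le_infty : minSmoothness ℝ 2 ≤ ∞ := by
  rw [minSmoothness_of_isRCLikeNormedField]
  exact WithTop.coe_le_coe.2 (le_top : (2 : ℕ∞) ≤ ⊤)

theorem fderiv_apply_const {N : ℕ} {E F : Type*} [NormedAddCommGroup E] [NormedSpace ℝ E]
    [NormedAddCommGroup F] [NormedSpace ℝ F] {A : Coord N → E →L[ℝ] F} {y : Coord N}
    (hA : DifferentiableAt ℝ A y) (v : E) (h : Coord N) :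
    fderiv ℝ (fun z => A z v) y h = fderiv ℝ A y h v := by
  rw [(hA.hasFDerivAt.clm_apply (hasFDerivAt_const v y)).fderiv]
  simp

theorem fderiv_apply_apply_const {N : ℕ} {E E' F : Type*} [NormedAddCommGroup E]
    [NormedSpace ℝ E] [NormedAddCommGroup E'] [NormedSpace ℝ E'] [NormedAddCommGroup F]
    [NormedSpace ℝ F] {A : Coord N → E →L[ℝ] E' →L[ℝ] F} {y : Coord N}
    (hA : DifferentiableAt ℝ A y) (v : E) (w : E') (h : Coord N) :
    fderiv ℝ (fun z => A z v w) y h = fderiv ℝ A y h v w := by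
  rw [fderiv_apply_const (A := fun z => A z v) (hA.clm_apply (differentiableAt_const v)),
    fderiv_apply_const hA]

theorem eq_of_partialVec {N : ℕ} {f g : Coord N →L[ℝ] ℝ}
    (h : ∀ i, f (partialVec i) = g (partialVec i)) : f = g := by
  apply ContinuousLinearMap.coe_injective
  exact (Pi.basisFun ℝ (Fin N)).ext fun i => by simpa [partialVec] using h i

theorem form_one_ext {N : ℕ} {α β : Coord N [⋀^Fin 1]→L[ℝ] ℝ}
    (h : ∀ i, α (fun _ => partialVec i) = β (fun _ => partialVec i)) : α = β := by
  have : toLinear (fun _ => α) 0 = toLinear (fun _ => β) 0 := eq_of_partialVec h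
  ext v
  calc α v = toLinear (fun _ => α) 0 (v 0) := form_one_apply (fun _ => α) 0 v
    _ = toLinear (fun _ => β) 0 (v 0) := by rw [this]
    _ = β v := (form_one_apply (fun _ => β) 0 v).symm

theorem etaDiag_mul_self (n : ℕ) {ε : ℝ} (hε : ε = 1 ∨ ε = -1) (α : Fin (n + 2)) :
    etaDiag n ε α * etaDiag n ε α = 1 := by
  unfold etaDiag
  rcases hε with rfl | rfl <;> split_ifs <;> norm_num

theorem ambientMetric_mul_self (n : ℕ) {ε : ℝ} (hε : ε = 1 ∨ ε = -1) (y : Coord (n + 2)) :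
    ambientMetric n ε y * ambientMetric n ε y = 1 := by
  rw [ambientMetric, Matrix.diagonal_mul_diagonal]
  simp [etaDiag_mul_self n hε]

theorem ambientMetric_inv (n : ℕ) {ε : ℝ} (hε : ε = 1 ∨ ε = -1) (y : Coord (n + 2)) :
    (ambientMetric n ε y)⁻¹ = ambientMetric n ε y :=
  Matrix.inv_eq_right_inv (ambientMetric_mul_self n hε y)

theorem abs_det_ambientMetric (n : ℕ) {ε : ℝ} (hε : ε = 1 ∨ ε = -1) (y : Coord (n + 2)) :
    |(ambientMetric n ε y).det| = 1 := by
  have h := congrArg Matrix.det (ambientMetric_mul_self n hε y)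
  rw [Matrix.det_mul, Matrix.det_one] at h
  rcases mul_self_eq_one_iff.1 h with h | h <;> simp [h]

theorem sharpBasis_ambientMetric (n : ℕ) {ε : ℝ} (hε : ε = 1 ∨ ε = -1) (y : Coord (n + 2))
    (i : Fin (n + 2)) :
    sharpBasis (ambientMetric n ε y) i = etaDiag n ε i • partialVec i := by
  funext j
  rw [sharpBasis, ambientMetric_inv n hε, ambientMetric]
  by_cases h : i = j
  · subst h; simp [partialVec]
  · simp [partialVec, h, Ne.symm h]

/-- The metric is constant with determinant ±1, so raising an index only multiplies by a diagonal
entry. The product over K appears on both sides and squares to 1. -/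
theorem codiff_ambient_apply (n p : ℕ) {ε : ℝ} (hε : ε = 1 ∨ ε = -1) {α : Form (n + 2) (p + 1)}
    {x : Coord (n + 2)} (hα : DifferentiableAt ℝ α x) (K : Fin p → Fin (n + 2)) :
    codiff (ambientMetric n ε) α x (fun k => partialVec (K k)) =
      -∑ i, etaDiag n ε i * fderiv ℝ (fun z => α z (Fin.cons (α := fun _ => Coord (n + 2))
        (partialVec i) (fun k => partialVec (K k)))) x (partialVec i) := by
  have hne : (ambientMetric n ε x).det ≠ 0 := by
    intro h; have := abs_det_ambientMetric n hε x; rw [h] at this; simp at this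
  have hd : ∀ I : Fin (p + 1) → Fin (n + 2), densitized (ambientMetric n ε) α I = fun z =>
      (∏ k, etaDiag n ε (I k)) * α z (fun k => partialVec (I k)) := by
    intro I
    funext z
    rw [densitized, abs_det_ambientMetric n hε, Real.sqrt_one, one_mul]
    simp only [sharpBasis_ambientMetric n hε]
    exact (α z).toMultilinearMap.map_smul_univ _ _
  have hev : ∀ v : Fin (p + 1) → Coord (n + 2), DifferentiableAt ℝ (fun z => α z v) x := fun v =>
    ((ContinuousAlternatingMap.apply ℝ (Coord (n + 2)) ℝ v).differentiableAt).comp x hα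
  have h := codiff_apply_sharp hne (Matrix.isSymm_diagonal _)
    (fun I => by rw [hd]; exact (hev _).const_mul _) K
  rw [abs_det_ambientMetric n hε] at h
  simp only [sharpBasis_ambientMetric n hε] at h
  have h2 : codiff (ambientMetric n ε) α x
      (fun k => etaDiag n ε (K k) • (partialVec (K k) : Coord (n + 2))) =
      (∏ k, etaDiag n ε (K k)) • codiff (ambientMetric n ε) α x (fun k => partialVec (K k)) :=
    (codiff (ambientMetric n ε) α x).toMultilinearMap.map_smul_univ _ _
  have hK : (∏ k, etaDiag n ε (K k)) * ∏ k, etaDiag n ε (K k) = 1 := by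
    rw [← Finset.prod_mul_distrib]
    simp [etaDiag_mul_self n hε]
  rw [h2] at h
  have h3 : ∀ i, fderiv ℝ (densitized (ambientMetric n ε) α
      (Fin.cons (α := fun _ => Fin (n + 2)) i K)) x (partialVec i) = (∏ k, etaDiag n ε (K k)) *
        (etaDiag n ε i * fderiv ℝ (fun z => α z (Fin.cons (α := fun _ => Coord (n + 2))
        (partialVec i) (fun k => partialVec (K k)))) x (partialVec i)) := by
    intro i
    rw [hd, fderiv_const_mul (hev _), Fin.prod_univ_succ]
    have : (fun k => (partialVec (Fin.cons (α := fun _ => Fin (n + 2)) i K k) : Coord (n + 2))) =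
        Fin.cons (α := fun _ => Coord (n + 2)) (partialVec i) (fun k => partialVec (K k)) := by
      funext k
      refine Fin.cases rfl (fun k => rfl) k
    simp only [this, Fin.cons_zero, Fin.cons_succ, _root_.smul_apply, smul_eq_mul]
    ring
  simp only [h3, ← Finset.mul_sum, smul_eq_mul] at h
  simp only [Real.sqrt_one, inv_one] at h
  linear_combination (∏ k, etaDiag n ε (K k)) * h - (codiff (ambientMetric n ε) α x
    (fun k => partialVec (K k)) + ∑ i, etaDiag n ε i * fderiv ℝ (fun z => α z
      (Fin.cons (α := fun _ => Coord (n + 2))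
        (partialVec i) (fun k => partialVec (K k)))) x (partialVec i)) * hK

/-- The flat Laplacian acts on the components of a one-form. -/
theorem laplaceDeRham_ambient_apply (n : ℕ) {ε : ℝ} (hε : ε = 1 ∨ ε = -1)
    {a : Form (n + 2) 1} {x : Coord (n + 2)} (ha : ContDiffAt ℝ ∞ a x) (w : Coord (n + 2)) :
    laplaceDeRham (ambientMetric n ε) a x (fun _ => w) =
      ∑ α, etaDiag n ε α *
        fderiv ℝ (fderiv ℝ (toLinear a)) x (partialVec α) (partialVec α) w := by
  set A := toLinear a with hA
  have hAx : ContDiffAt ℝ ∞ A x := contDiffAt_toLinear ha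
  have hDA : ContDiffAt ℝ ∞ (fderiv ℝ A) x := hAx.fderiv_right (m := ∞) (by simp)
  have hDd : DifferentiableAt ℝ (fderiv ℝ A) x := hDA.differentiableAt (by simp)
  have hsymm : ∀ v w, fderiv ℝ (fderiv ℝ A) x v w = fderiv ℝ (fderiv ℝ A) x w v :=
    fun v w => hAx.isSymmSndFDerivAt minSmoothness_two_le_infty v w
  have hnear : ∀ᶠ z in nhds x, DifferentiableAt ℝ a z :=
    ((ha.of_le (m := 1) (by exact_mod_cast le_top)).eventually (by simp)).mono
      fun z hz => hz.differentiableAt (by simp)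
  have hδ : (fun z => codiff (ambientMetric n ε) a z Fin.elim0) =ᶠ[nhds x]
      fun z => -∑ i, etaDiag n ε i * fderiv ℝ A z (partialVec i) (partialVec i) := by
    filter_upwards [hnear] with z hz
    have h := codiff_ambient_apply n 0 hε hz Fin.elim0
    rw [show (fun k => partialVec (Fin.elim0 k)) = (Fin.elim0 : Fin 0 → Coord (n + 2)) from
      funext fun k => k.elim0] at h
    rw [h]
    congr 1
    refine Finset.sum_congr rfl fun i _ => ?_
    congr 1
    have hAz : DifferentiableAt ℝ A z :=
      ((ContinuousAlternatingMap.ofSubsingletonLIE (𝕜 := ℝ) (E := Coord (n + 2))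
        (F := ℝ) (0 : Fin 1)).symm.differentiableAt).comp z hz
    rw [← fderiv_apply_const hAz]
    congr 2
    funext z
    rw [form_one_apply, Fin.cons_zero]
  have hF : DifferentiableAt ℝ (extDeriv a) x := by
    have : extDeriv a = ContinuousAlternatingMap.alternatizeUncurryFinCLM ℝ (Coord (n + 2)) ℝ ∘
      fderiv ℝ a := rfl
    rw [this]
    exact (ContinuousLinearMap.differentiableAt _).comp x
      ((ha.fderiv_right (m := ∞) (by simp)).differentiableAt (by simp))
  have key : toLinear (laplaceDeRham (ambientMetric n ε) a) x =
      ∑ α, etaDiag n ε α • fderiv ℝ (fderiv ℝ A) x (partialVec α) (partialVec α) := by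
    apply eq_of_partialVec
    intro k
    have h2 := codiff_ambient_apply n 1 hε hF (fun _ => k)
    rw [toLinear_apply, laplaceDeRham, ContinuousAlternatingMap.neg_apply,
      ContinuousAlternatingMap.add_apply, extDeriv_zeroForm_apply, h2, hδ.fderiv_eq]
    simp only [extDeriv_one_apply, ← hA, Fin.cons_zero, Fin.cons_one]
    have hd : ∀ v w, DifferentiableAt ℝ (fun z => fderiv ℝ A z v w) x := fun v w =>
      (hDd.clm_apply (differentiableAt_const v)).clm_apply (differentiableAt_const w)
    rw [fderiv_fun_neg, fderiv_fun_sum fun i _ => (hd _ _).const_mul _]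
    simp only [fderiv_const_mul (hd _ _), fderiv_fun_sub (hd _ _) (hd _ _), _root_.neg_apply,
      _root_.sum_apply, _root_.smul_apply, _root_.sub_apply, smul_eq_mul,
      fderiv_apply_apply_const hDd]
    rw [← neg_add, neg_neg, ← Finset.sum_add_distrib]
    refine Finset.sum_congr rfl fun i _ => ?_
    -- The mixed derivative from dδ cancels the one from δd.
    rw [hsymm (partialVec k) (partialVec i)]
    ring
  rw [← toLinear_apply, key]
  simp

/-! ### Geometry of `Σ_n` along a local parametrization -/

/-- The bilinear form `η` as a continuous bilinear map. -/
def etaForm (n : ℕ) (ε : ℝ) : Coord (n + 2) →L[ℝ] Coord (n + 2) →L[ℝ] ℝ :=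
  ∑ α, etaDiag n ε α • (ContinuousLinearMap.proj (R := ℝ) (φ := fun _ : Fin (n + 2) => ℝ)
    α).smulRight (ContinuousLinearMap.proj (R := ℝ) (φ := fun _ : Fin (n + 2) => ℝ) α)

theorem eta_eq (n : ℕ) (ε : ℝ) (v w : Coord (n + 2)) : eta n ε v w = etaForm n ε v w := by
  simp [eta, etaForm, mul_assoc]

theorem etaForm_comm (n : ℕ) (ε : ℝ) (v w : Coord (n + 2)) :
    etaForm n ε v w = etaForm n ε w v := by
  rw [← eta_eq, ← eta_eq, eta, eta]
  exact Finset.sum_congr rfl fun i _ => by ring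

theorem etaForm_partialVec (n : ℕ) (ε : ℝ) (v : Coord (n + 2)) (α : Fin (n + 2)) :
    etaForm n ε v (partialVec α) = etaDiag n ε α * v α := by
  rw [← eta_eq, eta, Finset.sum_eq_single α]
  · simp [partialVec]
  · intro β _ h
    simp [partialVec, h]
  · simp

theorem etaDiag_last (n : ℕ) (ε : ℝ) : etaDiag n ε (Fin.last (n + 1)) = ε := by
  simp [etaDiag]

/-- The projection along `∂_{n+1}`. -/
def dilationCLM (n : ℕ) : Coord (n + 2) →L[ℝ] Coord (n + 2) :=
  ContinuousLinearMap.id ℝ _ - (ContinuousLinearMap.proj (R := ℝ) (φ := fun _ : Fin (n + 2) => ℝ)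
    (Fin.last (n + 1))).smulRight (partialVec (Fin.last (n + 1)))

theorem dilationCLM_apply (n : ℕ) (y : Coord (n + 2)) : dilationCLM n y = dilationP n y := by
  funext α
  by_cases h : α = Fin.last (n + 1)
  · subst h; simp [dilationCLM, dilationP, partialVec]
  · simp [dilationCLM, dilationP, partialVec, h]

theorem dilationP_eq_sub (n : ℕ) (y : Coord (n + 2)) :
    dilationP n y = y - y (Fin.last (n + 1)) • partialVec (Fin.last (n + 1)) := by
  rw [← dilationCLM_apply]
  simp [dilationCLM]

theorem dilationP_last (n : ℕ) (y : Coord (n + 2)) : dilationP n y (Fin.last (n + 1)) = 0 := by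
  simp [dilationP]

theorem dilationP_of_last_eq_zero {n : ℕ} {y : Coord (n + 2)} (h : y (Fin.last (n + 1)) = 0) :
    dilationP n y = y := by
  rw [dilationP_eq_sub, h, zero_smul, sub_zero]

theorem fderiv_bilin {N : ℕ} {E E' F : Type*} [NormedAddCommGroup E]
    [NormedSpace ℝ E] [NormedAddCommGroup E'] [NormedSpace ℝ E'] [NormedAddCommGroup F]
    [NormedSpace ℝ F] (B : E →L[ℝ] E' →L[ℝ] F) {f : Coord N → E} {g : Coord N → E'} {x : Coord N}
    (hf : DifferentiableAt ℝ f x) (hg : DifferentiableAt ℝ g x) (v : Coord N) :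
    fderiv ℝ (fun z => B (f z) (g z)) x v = B (fderiv ℝ f x v) (g x) + B (f x) (fderiv ℝ g x v) := by
  have h := (B.hasFDerivAt.comp x hf.hasFDerivAt).clm_apply hg.hasFDerivAt
  rw [show (fun z => B (f z) (g z)) = fun z => (B ∘ f) z (g z) from rfl, h.fderiv]
  simp [add_comm]

theorem clm_apply_eq_sum {N : ℕ} {F : Type*} [NormedAddCommGroup F] [NormedSpace ℝ F]
    (L : Coord N →L[ℝ] F) (v : Coord N) : L v = ∑ k, v k • L (partialVec k) := by
  conv_lhs => rw [show v = ∑ k, v k • (partialVec k : Coord N) by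
    funext j; simp [partialVec, Pi.single_apply]]
  rw [map_sum]
  simp

namespace IsLocalParametrization

variable {n : ℕ} {ε H : ℝ} {U : Set (Coord n)} {φ : Coord n → Coord (n + 2)}
  (hφ : IsLocalParametrization n ε H U φ) {u : Coord n} (hu : u ∈ U)
include hφ hu

theorem eventually_mem : ∀ᶠ z in nhds u, z ∈ U := hφ.isOpen.mem_nhds hu

theorem contDiffAt : ContDiffAt ℝ ∞ φ u := hφ.smooth.contDiffAt (hφ.isOpen.mem_nhds hu)

theorem differentiableAt : DifferentiableAt ℝ φ u :=
  (hφ.contDiffAt hu).differentiableAt (by simp)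

theorem differentiableAt_fderiv : DifferentiableAt ℝ (fderiv ℝ φ) u :=
  ((hφ.contDiffAt hu).fderiv_right (m := ∞) (by simp)).differentiableAt (by simp)

theorem fderiv_last (v : Coord n) : fderiv ℝ φ u v (Fin.last (n + 1)) = 0 := by
  have h0 : (fun z => φ z (Fin.last (n + 1))) =ᶠ[nhds u] fun _ => φ u (Fin.last (n + 1)) := by
    filter_upwards [hφ.eventually_mem hu] with z hz
    have h1 := (hφ.mapsTo hz).2
    have h2 := (hφ.mapsTo hu).2
    have hH : H ≠ 0 := by rintro rfl; simp at h1
    exact mul_left_cancel₀ hH (h1.trans h2.symm)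
  have h := h0.fderiv_eq (𝕜 := ℝ)
  rw [fderiv_apply (hφ.differentiableAt hu), fderiv_fun_const] at h
  exact congrArg (fun L : Coord n →L[ℝ] ℝ => L v) h

theorem etaForm_fderiv (v : Coord n) : etaForm n ε (φ u) (fderiv ℝ φ u v) = 0 := by
  have h0 : (fun z => etaForm n ε (φ z) (φ z)) =ᶠ[nhds u] fun _ => 0 := by
    filter_upwards [hφ.eventually_mem hu] with z hz
    rw [← eta_eq]
    exact (hφ.mapsTo hz).1
  have h := congrArg (fun L : Coord n →L[ℝ] ℝ => L v) h0.fderiv_eq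
  simp only [fderiv_bilin _ (hφ.differentiableAt hu) (hφ.differentiableAt hu)] at h
  rw [etaForm_comm n ε (fderiv ℝ φ u v)] at h
  simp at h
  linarith

/-- D_P is normal to Σ_n: it differs from the position vector by a multiple of ∂_{n+1}, and both are
orthogonal to tangent vectors. -/
theorem etaForm_dilationP_fderiv (v : Coord n) :
    etaForm n ε (dilationP n (φ u)) (fderiv ℝ φ u v) = 0 := by
  rw [dilationP_eq_sub, map_sub, map_smul, _root_.sub_apply, _root_.smul_apply,
    hφ.etaForm_fderiv hu, etaForm_comm n ε (partialVec _), etaForm_partialVec,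
    hφ.fderiv_last hu]
  simp

/-- On the null cone y_P² = -ε (y^{n+1})², and y^{n+1} = 1/H on P. -/
theorem etaForm_dilationP_dilationP :
    etaForm n ε (dilationP n (φ u)) (dilationP n (φ u)) = -ε / H ^ 2 := by
  have h1 := (hφ.mapsTo hu).1
  have h2 := (hφ.mapsTo hu).2
  have hH : H ≠ 0 := by rintro rfl; simp at h2
  rw [eta_eq] at h1
  have h3 : φ u (Fin.last (n + 1)) = H⁻¹ := eq_inv_of_mul_eq_one_right h2
  have h4 : etaForm n ε (dilationP n (φ u)) (partialVec (Fin.last (n + 1))) = 0 := by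
    rw [etaForm_partialVec, dilationP_last, mul_zero]
  conv_lhs => arg 2; rw [dilationP_eq_sub]
  rw [map_sub, map_smul, h4, smul_zero, sub_zero, dilationP_eq_sub, map_sub, map_smul,
    _root_.sub_apply, _root_.smul_apply, h1, etaForm_comm, etaForm_partialVec, h3, etaDiag_last,
    smul_eq_mul]
  field_simp
  ring

theorem fderiv_dilationP (v : Coord n) :
    fderiv ℝ (fun z => dilationP n (φ z)) u v = fderiv ℝ φ u v := by
  have : (fun z => dilationP n (φ z)) = dilationCLM n ∘ φ :=
    funext fun z => (dilationCLM_apply n _).symm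
  rw [this, ((dilationCLM n).hasFDerivAt.comp u (hφ.differentiableAt hu).hasFDerivAt).fderiv,
    ContinuousLinearMap.comp_apply, dilationCLM_apply,
    dilationP_of_last_eq_zero (hφ.fderiv_last hu v)]

theorem differentiableAt_dilationP : DifferentiableAt ℝ (fun z => dilationP n (φ z)) u := by
  have : (fun z => dilationP n (φ z)) = dilationCLM n ∘ φ :=
    funext fun z => (dilationCLM_apply n _).symm
  rw [this]
  exact (dilationCLM n).differentiableAt.comp u (hφ.differentiableAt hu)

/-- The tangent vectors, the dilation field and `∂_{n+1}` span. -/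
theorem exists_decomposition (hε : ε = 1 ∨ ε = -1) (w : Coord (n + 2)) :
    ∃ (c : Coord n) (b d : ℝ), w = fderiv ℝ φ u c + b • dilationP n (φ u) +
      d • partialVec (Fin.last (n + 1)) := by
  let L : (Coord n × ℝ × ℝ) →ₗ[ℝ] Coord (n + 2) :=
    (fderiv ℝ φ u).toLinearMap.coprod
      ((LinearMap.toSpanSingleton ℝ _ (dilationP n (φ u))).coprod
        (LinearMap.toSpanSingleton ℝ _ (partialVec (Fin.last (n + 1)))))
  have hL : ∀ c b d, L (c, b, d) = fderiv ℝ φ u c + (b • dilationP n (φ u) +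
      d • partialVec (Fin.last (n + 1))) := fun c b d => by simp [L]
  have h2 := (hφ.mapsTo hu).2
  have hH : H ≠ 0 := by rintro rfl; simp at h2
  have hε0 : ε ≠ 0 := by rcases hε with rfl | rfl <;> norm_num
  -- The dimensions agree, n + 1 + 1 = n + 2, so injectivity suffices. The last coordinate detects
  -- d, and pairing with the non-null D_P detects b.
  have hinj : Function.Injective L := by
    rw [← LinearMap.ker_eq_bot, LinearMap.ker_eq_bot']
    rintro ⟨c, b, d⟩ h
    rw [hL] at h
    have hd : d = 0 := by
      have := congrFun h (Fin.last (n + 1))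
      simpa [hφ.fderiv_last hu, dilationP_last, partialVec] using this
    subst hd
    have hb : b = 0 := by
      have := congrArg (etaForm n ε (dilationP n (φ u))) h
      rw [zero_smul, add_zero, map_add, map_smul, hφ.etaForm_dilationP_fderiv hu,
        hφ.etaForm_dilationP_dilationP hu, map_zero, zero_add, smul_eq_mul] at this
      rcases mul_eq_zero.1 this with h | h
      · exact h
      · exact absurd h (div_ne_zero (neg_ne_zero.2 hε0) (pow_ne_zero _ hH))
    subst hb
    have hc : c = 0 := by
      apply hφ.immersion u hu
      simpa using h
    rw [hc]
    rfl
  have hsurj : Function.Surjective L :=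
    (LinearMap.injective_iff_surjective_of_finrank_eq_finrank (by simp)).1 hinj
  obtain ⟨⟨c, b, d⟩, h⟩ := hsurj w
  exact ⟨c, b, d, h.symm.trans ((hL c b d).trans (add_assoc _ _ _).symm)⟩

/-- Nondegeneracy of η tested on the spanning set of `exists_decomposition`; the last coordinate
stands for the pairing with ∂_{n+1}. -/
theorem eq_zero_of_orthogonal (hε : ε = 1 ∨ ε = -1) {w : Coord (n + 2)}
    (ht : ∀ i, etaForm n ε w (fderiv ℝ φ u (partialVec i)) = 0)
    (hP : etaForm n ε w (dilationP n (φ u)) = 0) (hl : w (Fin.last (n + 1)) = 0) : w = 0 := by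
  have hall : ∀ v, etaForm n ε w v = 0 := by
    intro v
    obtain ⟨c, b, d, rfl⟩ := hφ.exists_decomposition hu hε v
    have h1 : etaForm n ε w (fderiv ℝ φ u c) = 0 := by
      rw [clm_apply_eq_sum (fderiv ℝ φ u) c, map_sum]
      simp [ht]
    rw [map_add, map_add, map_smul, map_smul, h1, hP, etaForm_partialVec, hl]
    simp
  funext α
  have h := hall (partialVec α)
  rw [etaForm_partialVec] at h
  have := etaDiag_mul_self n hε α
  rcases mul_eq_zero.1 h with h | h
  · rw [h] at this; simp at this
  · exact h

omit hφ hu in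
theorem inducedMetric_apply (u : Coord n) (i j : Fin n) : inducedMetric n ε φ u i j =
    etaForm n ε (fderiv ℝ φ u (partialVec i)) (fderiv ℝ φ u (partialVec j)) := by
  rw [← eta_eq]
  rfl

omit hφ hu in
theorem inducedMetric_isSymm (u : Coord n) : (inducedMetric n ε φ u).IsSymm := by
  ext i j
  rw [Matrix.transpose_apply, inducedMetric_apply, inducedMetric_apply, etaForm_comm]

/-- A kernel vector of the Gram matrix would give a tangent vector orthogonal to the tangent space
and to both normals, hence zero. -/
theorem det_inducedMetric_ne_zero (hε : ε = 1 ∨ ε = -1) : (inducedMetric n ε φ u).det ≠ 0 := by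
  intro h
  obtain ⟨c, hc, hgc⟩ := Matrix.exists_mulVec_eq_zero_iff.2 h
  apply hc
  apply hφ.immersion u hu
  rw [map_zero]
  refine hφ.eq_zero_of_orthogonal hu hε (fun i => ?_) ?_ (hφ.fderiv_last hu c)
  · have := congrFun hgc i
    rw [etaForm_comm, clm_apply_eq_sum (fderiv ℝ φ u) c, map_sum]
    simp only [Matrix.mulVec, dotProduct, inducedMetric_apply, Pi.zero_apply] at this
    rw [← this]
    exact Finset.sum_congr rfl fun j _ => by rw [map_smul, smul_eq_mul, mul_comm]
  · rw [etaForm_comm, hφ.etaForm_dilationP_fderiv hu]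

end IsLocalParametrization

/-! ### Reciprocal frame, completeness relation and tangential trace. -/

/-- The reciprocal tangent frame `g^{ij} ∂_j φ`. -/
def raisedVec (n : ℕ) (ε : ℝ) (φ : Coord n → Coord (n + 2)) (i : Fin n) (u : Coord n) :
    Coord (n + 2) :=
  fderiv ℝ φ u (sharpBasis (inducedMetric n ε φ u) i)

theorem raisedVec_eq_sum (n : ℕ) (ε : ℝ) (φ : Coord n → Coord (n + 2)) (i : Fin n)
    (u : Coord n) : raisedVec n ε φ i u =
      ∑ k, (inducedMetric n ε φ u)⁻¹ i k • fderiv ℝ φ u (partialVec k) := by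
  rw [raisedVec, clm_apply_eq_sum (fderiv ℝ φ u)]
  rfl

namespace IsLocalParametrization

variable {n : ℕ} {ε H : ℝ} {U : Set (Coord n)} {φ : Coord n → Coord (n + 2)}
  (hφ : IsLocalParametrization n ε H U φ) {u : Coord n} (hu : u ∈ U) (hε : ε = 1 ∨ ε = -1)
include hφ hu hε

theorem etaForm_raisedVec (i j : Fin n) :
    etaForm n ε (raisedVec n ε φ i u) (fderiv ℝ φ u (partialVec j)) = if i = j then 1 else 0 := by
  have h := Matrix.nonsing_inv_mul (inducedMetric n ε φ u)
    (hφ.det_inducedMetric_ne_zero hu hε).isUnit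
  have := congrFun (congrFun h i) j
  rw [Matrix.mul_apply, Matrix.one_apply] at this
  rw [← this, raisedVec_eq_sum, map_sum, _root_.sum_apply]
  exact Finset.sum_congr rfl fun k _ => by
    rw [map_smul, _root_.smul_apply, inducedMetric_apply, smul_eq_mul]

omit hε in
theorem etaForm_raisedVec_dilationP (i : Fin n) :
    etaForm n ε (raisedVec n ε φ i u) (dilationP n (φ u)) = 0 := by
  rw [etaForm_comm, raisedVec, hφ.etaForm_dilationP_fderiv hu]

omit hε in
theorem raisedVec_last (i : Fin n) : raisedVec n ε φ i u (Fin.last (n + 1)) = 0 :=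
  hφ.fderiv_last hu _

theorem sum_inducedMetric_raisedVec (j : Fin n) :
    ∑ k, inducedMetric n ε φ u j k • raisedVec n ε φ k u = fderiv ℝ φ u (partialVec j) := by
  have h := Matrix.mul_nonsing_inv (inducedMetric n ε φ u)
    (hφ.det_inducedMetric_ne_zero hu hε).isUnit
  simp only [raisedVec, ← map_smul, ← map_sum]
  congr 1
  funext l
  have := congrFun (congrFun h j) l
  rw [Matrix.mul_apply] at this
  simp only [Finset.sum_apply, Pi.smul_apply, sharpBasis, smul_eq_mul]
  rw [this]
  simp [partialVec, Matrix.one_apply, Pi.single_apply, eq_comm]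

/-- The orthogonal expansion of v in tangent and normal directions. The coefficient -εH² is 1/η(D_P,
D_P), because ε² = 1. -/
theorem completeness (v : Coord (n + 2)) :
    v = ∑ i, etaForm n ε v (fderiv ℝ φ u (partialVec i)) • raisedVec n ε φ i u -
      (ε * H ^ 2 * etaForm n ε v (dilationP n (φ u))) • dilationP n (φ u) +
      v (Fin.last (n + 1)) • partialVec (Fin.last (n + 1)) := by
  have hH2 := (hφ.mapsTo hu).2
  have hH : H ≠ 0 := by rintro rfl; simp at hH2
  have hεε : ε * ε = 1 := by rcases hε with rfl | rfl <;> norm_num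
  rw [← sub_eq_zero]
  apply hφ.eq_zero_of_orthogonal hu hε
  · intro m
    simp only [map_sub, map_add, map_sum, map_smul, _root_.sub_apply, _root_.add_apply,
      _root_.sum_apply, _root_.smul_apply, hφ.etaForm_raisedVec hu hε,
      hφ.etaForm_dilationP_fderiv hu, etaForm_comm n ε (partialVec _), etaForm_partialVec,
      hφ.fderiv_last hu]
    simp
  · simp only [map_sub, map_add, map_sum, map_smul, _root_.sub_apply, _root_.add_apply,
      _root_.sum_apply, _root_.smul_apply, hφ.etaForm_raisedVec_dilationP hu,
      hφ.etaForm_dilationP_dilationP hu, etaForm_comm n ε (partialVec _), etaForm_partialVec,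
      dilationP_last]
    simp only [smul_eq_mul, mul_zero, Finset.sum_const_zero]
    field_simp
    linear_combination (-etaForm n ε v (dilationP n (φ u))) * hεε
  · simp [hφ.raisedVec_last hu, dilationP_last, partialVec]

/-- The trace over the tangent space in terms of the ambient trace. -/
theorem sum_tangent_trace (B : Coord (n + 2) →L[ℝ] Coord (n + 2) →L[ℝ] ℝ) :
    ∑ i, B (fderiv ℝ φ u (partialVec i)) (raisedVec n ε φ i u) =
      ∑ α, etaDiag n ε α * B (partialVec α) (partialVec α) +
        ε * H ^ 2 * B (dilationP n (φ u)) (dilationP n (φ u)) -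
        ε * B (partialVec (Fin.last (n + 1))) (partialVec (Fin.last (n + 1))) := by
  -- The second ∂_α is expanded by `completeness`; summing over α then reassembles E_i, D_P and
  -- ∂_{n+1} in the first slot.
  have h : ∀ α, etaDiag n ε α * B (partialVec α) (partialVec α) =
      ∑ i, fderiv ℝ φ u (partialVec i) α * B (partialVec α) (raisedVec n ε φ i u) -
        ε * H ^ 2 * (dilationP n (φ u) α * B (partialVec α) (dilationP n (φ u))) +
        etaDiag n ε α * (partialVec α : Coord (n + 2)) (Fin.last (n + 1)) *
          B (partialVec α) (partialVec (Fin.last (n + 1))) := by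
    intro α
    have hη := etaDiag_mul_self n hε α
    have hc := congrArg (B (partialVec α)) (hφ.completeness hu hε (partialVec α))
    simp only [map_add, map_sub, map_sum, map_smul, etaForm_comm n ε (partialVec α),
      etaForm_partialVec, smul_eq_mul] at hc
    rw [hc, mul_add, mul_sub, Finset.mul_sum]
    have e1 : ∀ i, etaDiag n ε α * (etaDiag n ε α * fderiv ℝ φ u (partialVec i) α *
        B (partialVec α) (raisedVec n ε φ i u)) =
        fderiv ℝ φ u (partialVec i) α * B (partialVec α) (raisedVec n ε φ i u) := fun i => by
      linear_combination (fderiv ℝ φ u (partialVec i) α *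
        B (partialVec α) (raisedVec n ε φ i u)) * hη
    simp only [e1]
    linear_combination (-(ε * H ^ 2 * (dilationP n (φ u) α *
      B (partialVec α) (dilationP n (φ u))))) * hη
  simp only [h]
  rw [Finset.sum_add_distrib, Finset.sum_sub_distrib, Finset.sum_comm, ← Finset.mul_sum]
  have hB : ∀ v w, ∑ α, v α * B (partialVec α) w = B v w := by
    intro v w
    rw [clm_apply_eq_sum B v, _root_.sum_apply]
    rfl
  simp only [hB]
  have e : (fun α => etaDiag n ε α * (partialVec α : Coord (n + 2)) (Fin.last (n + 1))) =
      ε • partialVec (Fin.last (n + 1)) := by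
    funext β
    by_cases hβ : β = Fin.last (n + 1)
    · subst hβ; simp [partialVec, etaDiag_last]
    · simp [partialVec, hβ, Ne.symm hβ]
  rw [e, map_smul, _root_.smul_apply, smul_eq_mul]
  ring

end IsLocalParametrization

namespace IsLocalParametrization

variable {n : ℕ} {ε H : ℝ} {U : Set (Coord n)} {φ : Coord n → Coord (n + 2)}
  (hφ : IsLocalParametrization n ε H U φ) {u : Coord n} (hu : u ∈ U)
include hφ hu

/-! ### Derivatives of the tangent and reciprocal frames -/

theorem differentiableAt_tangent (i : Fin n) :
    DifferentiableAt ℝ (fun z => fderiv ℝ φ z (partialVec i)) u :=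
  (hφ.differentiableAt_fderiv hu).clm_apply (differentiableAt_const _)

theorem fderiv_tangent (i : Fin n) (v : Coord n) :
    fderiv ℝ (fun z => fderiv ℝ φ z (partialVec i)) u v =
      fderiv ℝ (fderiv ℝ φ) u v (partialVec i) :=
  fderiv_apply_const (hφ.differentiableAt_fderiv hu) _ _

theorem second_fderiv_comm (v w : Coord n) :
    fderiv ℝ (fderiv ℝ φ) u v w = fderiv ℝ (fderiv ℝ φ) u w v :=
  (hφ.contDiffAt hu).isSymmSndFDerivAt minSmoothness_two_le_infty v w

omit hφ hu in
theorem differentiableAt_etaForm_comp {f g : Coord n → Coord (n + 2)}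
    (hf : DifferentiableAt ℝ f u) (hg : DifferentiableAt ℝ g u) :
    DifferentiableAt ℝ (fun z => etaForm n ε (f z) (g z)) u :=
  ((etaForm n ε).differentiableAt.comp u hf).clm_apply hg

theorem differentiableAt_inducedMetric (i j : Fin n) :
    DifferentiableAt ℝ (fun z => inducedMetric n ε φ z i j) u := by
  simp only [inducedMetric_apply]
  exact differentiableAt_etaForm_comp (hφ.differentiableAt_tangent hu i)
    (hφ.differentiableAt_tangent hu j)

theorem fderiv_inducedMetric (i j : Fin n) (v : Coord n) :
    fderiv ℝ (fun z => inducedMetric n ε φ z i j) u v =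
      etaForm n ε (fderiv ℝ (fderiv ℝ φ) u v (partialVec i)) (fderiv ℝ φ u (partialVec j)) +
      etaForm n ε (fderiv ℝ φ u (partialVec i)) (fderiv ℝ (fderiv ℝ φ) u v (partialVec j)) := by
  simp only [inducedMetric_apply]
  rw [fderiv_bilin _ (hφ.differentiableAt_tangent hu i) (hφ.differentiableAt_tangent hu j),
    hφ.fderiv_tangent hu, hφ.fderiv_tangent hu]

variable (hε : ε = 1 ∨ ε = -1)
include hε

theorem differentiableAt_raisedVec (i : Fin n) :
    DifferentiableAt ℝ (raisedVec n ε φ i) u := by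
  have : raisedVec n ε φ i = fun z => ∑ k, (inducedMetric n ε φ z)⁻¹ i k •
      fderiv ℝ φ z (partialVec k) := funext fun z => raisedVec_eq_sum n ε φ i z
  rw [this]
  exact DifferentiableAt.fun_sum fun k _ =>
    (differentiableAt_inv_apply (fun a b => hφ.differentiableAt_inducedMetric hu a b)
      (hφ.det_inducedMetric_ne_zero hu hε) i k).smul (hφ.differentiableAt_tangent hu k)

theorem etaForm_fderiv_raisedVec (k l : Fin n) (v : Coord n) :
    etaForm n ε (fderiv ℝ (raisedVec n ε φ k) u v) (fderiv ℝ φ u (partialVec l)) =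
      -etaForm n ε (raisedVec n ε φ k u) (fderiv ℝ (fderiv ℝ φ) u v (partialVec l)) := by
  have h0 : (fun z => etaForm n ε (raisedVec n ε φ k z) (fderiv ℝ φ z (partialVec l)))
      =ᶠ[nhds u] fun _ => if k = l then 1 else 0 := by
    filter_upwards [hφ.eventually_mem hu] with z hz
    exact hφ.etaForm_raisedVec hz hε k l
  have h := congrArg (fun L : Coord n →L[ℝ] ℝ => L v) h0.fderiv_eq
  simp only [fderiv_bilin _ (hφ.differentiableAt_raisedVec hu hε k)
    (hφ.differentiableAt_tangent hu l), hφ.fderiv_tangent hu, fderiv_fun_const] at h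
  exact eq_neg_of_add_eq_zero_left h

theorem etaForm_fderiv_raisedVec_dilationP (k : Fin n) (v : Coord n) :
    etaForm n ε (fderiv ℝ (raisedVec n ε φ k) u v) (dilationP n (φ u)) =
      -etaForm n ε (raisedVec n ε φ k u) (fderiv ℝ φ u v) := by
  have h0 : (fun z => etaForm n ε (raisedVec n ε φ k z) (dilationP n (φ z)))
      =ᶠ[nhds u] fun _ => 0 := by
    filter_upwards [hφ.eventually_mem hu] with z hz
    exact hφ.etaForm_raisedVec_dilationP hz k
  have h := congrArg (fun L : Coord n →L[ℝ] ℝ => L v) h0.fderiv_eq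
  simp only [fderiv_bilin _ (hφ.differentiableAt_raisedVec hu hε k)
    (hφ.differentiableAt_dilationP hu), hφ.fderiv_dilationP hu, fderiv_fun_const] at h
  exact eq_neg_of_add_eq_zero_left h

theorem fderiv_raisedVec_last (k : Fin n) (v : Coord n) :
    fderiv ℝ (raisedVec n ε φ k) u v (Fin.last (n + 1)) = 0 := by
  have h0 : (fun z => raisedVec n ε φ k z (Fin.last (n + 1))) =ᶠ[nhds u] fun _ => 0 := by
    filter_upwards [hφ.eventually_mem hu] with z hz
    exact hφ.raisedVec_last hz k
  have h := h0.fderiv_eq (𝕜 := ℝ)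
  rw [fderiv_apply (hφ.differentiableAt_raisedVec hu hε k), fderiv_fun_const] at h
  exact congrArg (fun L : Coord n →L[ℝ] ℝ => L v) h

/-- Gauss's formula for the reciprocal frame. Differentiating the constant pairings with E_l and D_P
gives the coefficients: Christoffel symbols along the tangent frame, and a D_P-component in which
the derivative of D_P along Σ_n is the tangent vector itself. -/
theorem fderiv_raisedVec_eq (k : Fin n) (v : Coord n) :
    fderiv ℝ (raisedVec n ε φ k) u v =
      -∑ l, etaForm n ε (raisedVec n ε φ k u) (fderiv ℝ (fderiv ℝ φ) u v (partialVec l)) •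
        raisedVec n ε φ l u +
      (ε * H ^ 2 * etaForm n ε (raisedVec n ε φ k u) (fderiv ℝ φ u v)) • dilationP n (φ u) := by
  conv_lhs => rw [hφ.completeness hu hε (fderiv ℝ (raisedVec n ε φ k) u v)]
  simp only [hφ.etaForm_fderiv_raisedVec hu hε, hφ.etaForm_fderiv_raisedVec_dilationP hu hε,
    hφ.fderiv_raisedVec_last hu hε, neg_smul, Finset.sum_neg_distrib, mul_neg, zero_smul, add_zero,
    sub_neg_eq_add]

/-- In Jacobi's formula the two halves of the derivative of g_{ij} contract equally with the
symmetric inverse, which removes the factor 1/2 and leaves the contracted Christoffel symbol. -/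
theorem hasFDerivAt_density : ∃ D : Coord n →L[ℝ] ℝ,
    HasFDerivAt (fun z => √|(inducedMetric n ε φ z).det|) D u ∧ ∀ v, D v =
      √|(inducedMetric n ε φ u).det| * ∑ k, etaForm n ε (raisedVec n ε φ k u)
        (fderiv ℝ (fderiv ℝ φ) u v (partialVec k)) := by
  obtain ⟨D, hD, hDv⟩ := hasFDerivAt_sqrt_abs_det
    (fun a b => hφ.differentiableAt_inducedMetric hu (ε := ε) a b)
    (hφ.det_inducedMetric_ne_zero hu hε)
  refine ⟨D, hD, fun v => ?_⟩
  rw [hDv]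
  congr 1
  simp only [hφ.fderiv_inducedMetric hu, mul_add, Finset.sum_add_distrib]
  have hsymm : ∀ i j, (inducedMetric n ε φ u)⁻¹ i j = (inducedMetric n ε φ u)⁻¹ j i := by
    intro i j
    conv_lhs => rw [← (inducedMetric_isSymm u).eq, ← Matrix.transpose_nonsing_inv,
      Matrix.transpose_apply]
  have e : ∀ k, etaForm n ε (raisedVec n ε φ k u)
      (fderiv ℝ (fderiv ℝ φ) u v (partialVec k)) = ∑ i, (inducedMetric n ε φ u)⁻¹ k i *
        etaForm n ε (fderiv ℝ φ u (partialVec i)) (fderiv ℝ (fderiv ℝ φ) u v (partialVec k)) := by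
    intro k
    rw [raisedVec_eq_sum, map_sum, _root_.sum_apply]
    exact Finset.sum_congr rfl fun i _ => by rw [map_smul]; rfl
  have e1 : ∑ i, ∑ j, (inducedMetric n ε φ u)⁻¹ j i * etaForm n ε (fderiv ℝ φ u (partialVec i))
      (fderiv ℝ (fderiv ℝ φ) u v (partialVec j)) = ∑ k, etaForm n ε (raisedVec n ε φ k u)
      (fderiv ℝ (fderiv ℝ φ) u v (partialVec k)) := by
    rw [Finset.sum_comm]
    exact Finset.sum_congr rfl fun k _ => (e k).symm
  have e2 : ∑ i, ∑ j, (inducedMetric n ε φ u)⁻¹ j i *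
      etaForm n ε (fderiv ℝ (fderiv ℝ φ) u v (partialVec i)) (fderiv ℝ φ u (partialVec j)) =
      ∑ k, etaForm n ε (raisedVec n ε φ k u)
      (fderiv ℝ (fderiv ℝ φ) u v (partialVec k)) := by
    refine Finset.sum_congr rfl fun i _ => ?_
    rw [e]
    exact Finset.sum_congr rfl fun j _ => by rw [hsymm j i, etaForm_comm]
  rw [e1, e2]
  ring

theorem fderiv_density_smul_raisedVec (i : Fin n) (v : Coord n) :
    fderiv ℝ (fun z => √|(inducedMetric n ε φ z).det| • raisedVec n ε φ i z) u v =
      √|(inducedMetric n ε φ u).det| • (fderiv ℝ (raisedVec n ε φ i) u v +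
        (∑ k, etaForm n ε (raisedVec n ε φ k u)
          (fderiv ℝ (fderiv ℝ φ) u v (partialVec k))) • raisedVec n ε φ i u) := by
  obtain ⟨D, hD, hDv⟩ := hφ.hasFDerivAt_density hu hε
  rw [(hD.fun_smul (hφ.differentiableAt_raisedVec hu hε i).hasFDerivAt).fderiv]
  simp only [_root_.add_apply, _root_.smul_apply, ContinuousLinearMap.smulRight_apply, hDv,
    smul_add, smul_smul]

/-- The mean curvature vector: `|g|^{-1/2} ∂_i (|g|^{1/2} g^{ij} ∂_j φ) = n ε H² D_P`. -/
theorem sum_fderiv_density_raisedVec :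
    ∑ i, fderiv ℝ (fun z => √|(inducedMetric n ε φ z).det| • raisedVec n ε φ i z) u
      (partialVec i) =
      (√|(inducedMetric n ε φ u).det| * (n * ε * H ^ 2)) • dilationP n (φ u) := by
  have hH2 := (hφ.mapsTo hu).2
  have hH : H ≠ 0 := by rintro rfl; simp at hH2
  have hεε : ε * ε = 1 := by rcases hε with rfl | rfl <;> norm_num
  simp only [hφ.fderiv_density_smul_raisedVec hu hε, ← Finset.smul_sum, mul_smul]
  congr 1
  rw [Finset.sum_add_distrib]
  simp only [hφ.fderiv_raisedVec_eq hu hε, hφ.etaForm_raisedVec hu hε]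
  rw [Finset.sum_add_distrib, Finset.sum_neg_distrib, Finset.sum_comm (γ := Fin n)]
  simp only [← Finset.sum_smul]
  -- Symmetry of the second derivative of φ cancels the tangential part against the derivative of
  -- the density. The normal part is summed over i, which produces n.
  have e : ∀ y, (∑ i, etaForm n ε (raisedVec n ε φ i u)
      (fderiv ℝ (fderiv ℝ φ) u (partialVec i) (partialVec y))) = ∑ i,
      etaForm n ε (raisedVec n ε φ i u)
      (fderiv ℝ (fderiv ℝ φ) u (partialVec y) (partialVec i)) := fun y =>
    Finset.sum_congr rfl fun i _ => by rw [hφ.second_fderiv_comm hu (partialVec i)]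
  simp only [e]
  rw [neg_add_eq_sub, sub_add_cancel]
  simp only [if_true, mul_one, Finset.sum_const, Finset.card_univ, Fintype.card_fin, smul_smul,
    nsmul_eq_mul]

/-- The Christoffel part is symmetric in the two indices contracted with the alternating f, so only
the component along D_P survives. -/
theorem sum_alternating_fderiv_raisedVec (f : Coord (n + 2) →L[ℝ] Coord (n + 2) →L[ℝ] ℝ)
    (hf : ∀ v w, f v w = -f w v) (j : Fin n) :
    ∑ i, ∑ k, inducedMetric n ε φ u j k *
        f (raisedVec n ε φ i u) (fderiv ℝ (raisedVec n ε φ k) u (partialVec i)) =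
      ε * H ^ 2 * f (fderiv ℝ φ u (partialVec j)) (dilationP n (φ u)) := by
  have e : ∀ i, ∑ k, inducedMetric n ε φ u j k *
        f (raisedVec n ε φ i u) (fderiv ℝ (raisedVec n ε φ k) u (partialVec i)) =
      -(∑ l, etaForm n ε (fderiv ℝ φ u (partialVec j))
          (fderiv ℝ (fderiv ℝ φ) u (partialVec i) (partialVec l)) *
            f (raisedVec n ε φ i u) (raisedVec n ε φ l u)) +
        ε * H ^ 2 * (inducedMetric n ε φ u j i * f (raisedVec n ε φ i u) (dilationP n (φ u))) := by
    intro i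
    simp only [hφ.fderiv_raisedVec_eq hu hε, hφ.etaForm_raisedVec hu hε, map_add, map_neg, map_sum,
      map_smul, smul_eq_mul, mul_add, Finset.sum_add_distrib]
    congr 1
    · rw [← hφ.sum_inducedMetric_raisedVec hu hε j]
      simp only [map_sum, map_smul, _root_.sum_apply, _root_.smul_apply, smul_eq_mul,
        Finset.sum_mul, mul_neg, Finset.sum_neg_distrib, Finset.mul_sum]
      rw [Finset.sum_comm]
      simp only [mul_assoc]
    · rw [Finset.sum_eq_single i]
      · simp only [if_true]; ring
      · intro b _ hb
        simp [hb]
      · simp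
  simp only [e]
  rw [Finset.sum_add_distrib, ← Finset.mul_sum, Finset.sum_neg_distrib]
  have e0 : ∑ i, ∑ l, etaForm n ε (fderiv ℝ φ u (partialVec j))
          (fderiv ℝ (fderiv ℝ φ) u (partialVec i) (partialVec l)) *
            f (raisedVec n ε φ i u) (raisedVec n ε φ l u) = 0 := by
    apply self_eq_neg.1
    conv_lhs => rw [Finset.sum_comm]
    simp only [← Finset.sum_neg_distrib]
    refine Finset.sum_congr rfl fun i _ => Finset.sum_congr rfl fun l _ => ?_
    rw [hφ.second_fderiv_comm hu (partialVec l), hf (raisedVec n ε φ l u)]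
    ring
  rw [e0, neg_zero, zero_add, ← hφ.sum_inducedMetric_raisedVec hu hε j]
  simp only [map_sum, map_smul, _root_.sum_apply, _root_.smul_apply, smul_eq_mul]

end IsLocalParametrization

/-! ### Lie derivatives along the dilation field -/

theorem fderiv_clm_apply_apply {N : ℕ} {E F : Type*} [NormedAddCommGroup E]
    [NormedSpace ℝ E] [NormedAddCommGroup F] [NormedSpace ℝ F] {A : Coord N → E →L[ℝ] F}
    {g : Coord N → E} {x : Coord N} (hA : DifferentiableAt ℝ A x) (hg : DifferentiableAt ℝ g x)
    (v : Coord N) :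
    fderiv ℝ (fun z => A z (g z)) x v = fderiv ℝ A x v (g x) + A x (fderiv ℝ g x v) := by
  rw [(hA.hasFDerivAt.clm_apply hg.hasFDerivAt).fderiv]
  simp [add_comm]

theorem dilationP_eq_clm (n : ℕ) : dilationP n = dilationCLM n :=
  funext fun y => (dilationCLM_apply n y).symm

theorem differentiable_dilationP (n : ℕ) (y : Coord (n + 2)) :
    DifferentiableAt ℝ (dilationP n) y := by
  rw [dilationP_eq_clm]
  exact (dilationCLM n).differentiableAt

theorem fderiv_dilationP_apply (n : ℕ) (y v : Coord (n + 2)) :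
    fderiv ℝ (dilationP n) y v = dilationP n v := by
  rw [dilationP_eq_clm, ContinuousLinearMap.fderiv]

theorem dilationP_dilationP (n : ℕ) (y : Coord (n + 2)) :
    dilationP n (dilationP n y) = dilationP n y :=
  dilationP_of_last_eq_zero (dilationP_last n y)

theorem extDeriv_interior_dilationP_apply {n : ℕ} {a : Form (n + 2) 1} {y : Coord (n + 2)}
    (ha : DifferentiableAt ℝ (toLinear a) y) (v : Coord (n + 2)) :
    extDeriv (interior (dilationP n) a) y (fun _ => v) =
      fderiv ℝ (toLinear a) y v (dilationP n y) + toLinear a y (dilationP n v) := by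
  rw [extDeriv_zeroForm_apply]
  have : (fun z => interior (dilationP n) a z Fin.elim0) = fun z => toLinear a z (dilationP n z) := by
    funext z
    rw [interior, ContinuousAlternatingMap.curryLeft_apply_apply, form_one_apply]
    rfl
  rw [this, fderiv_clm_apply_apply ha (differentiable_dilationP n y), fderiv_dilationP_apply]

/-- In Cartan's formula the derivative of a in the direction v cancels. Since D_P is linear, its
derivative contributes the projection of v. -/
theorem lieDerivative_dilationP_apply {n : ℕ} {a : Form (n + 2) 1} {y : Coord (n + 2)}
    (ha : DifferentiableAt ℝ (toLinear a) y) (v : Coord (n + 2)) :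
    lieDerivative (dilationP n) a y (fun _ => v) =
      fderiv ℝ (toLinear a) y (dilationP n y) v + toLinear a y (dilationP n v) := by
  rw [lieDerivative, ContinuousAlternatingMap.add_apply, extDeriv_interior_dilationP_apply ha,
    interior, ContinuousAlternatingMap.curryLeft_apply_apply, extDeriv_one_apply]
  change fderiv ℝ (toLinear a) y (dilationP n y) v - fderiv ℝ (toLinear a) y v (dilationP n y) + _ = _
  ring

/-- The coefficient 3 counts the derivative of D_P along itself, the derivative of the zeroth-order
term of the inner Lie derivative, and the zeroth-order term of the outer one. -/
theorem lieDerivative_lieDerivative_dilationP_apply {n : ℕ} {a : Form (n + 2) 1}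
    {y : Coord (n + 2)} (ha : ContDiffAt ℝ ∞ (toLinear a) y) {v : Coord (n + 2)}
    (hv : v (Fin.last (n + 1)) = 0) :
    lieDerivative (dilationP n) (lieDerivative (dilationP n) a) y (fun _ => v) =
      fderiv ℝ (fderiv ℝ (toLinear a)) y (dilationP n y) (dilationP n y) v +
        3 * fderiv ℝ (toLinear a) y (dilationP n y) v + toLinear a y v := by
  have hDA : DifferentiableAt ℝ (fderiv ℝ (toLinear a)) y :=
    (ha.fderiv_right (m := ∞) (by simp)).differentiableAt (by simp)
  have hA : DifferentiableAt ℝ (toLinear a) y := ha.differentiableAt (by simp)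
  have hnear : toLinear (lieDerivative (dilationP n) a) =ᶠ[nhds y] fun z =>
      fderiv ℝ (toLinear a) z (dilationP n z) + (toLinear a z).comp (dilationCLM n) := by
    filter_upwards [(ha.of_le (m := 1) (by exact_mod_cast le_top)).eventually (by simp)] with z hz
    ext w
    rw [toLinear_apply, lieDerivative_dilationP_apply (hz.differentiableAt (by simp)),
      _root_.add_apply, ContinuousLinearMap.comp_apply, dilationCLM_apply]
  have hd1 : DifferentiableAt ℝ (fun z => fderiv ℝ (toLinear a) z (dilationP n z)) y :=
    hDA.clm_apply (differentiable_dilationP n y)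
  have hd2 : DifferentiableAt ℝ (fun z => (toLinear a z).comp (dilationCLM n)) y :=
    hA.clm_comp (differentiableAt_const _)
  have hd := (hd1.fun_add hd2).congr_of_eventuallyEq hnear
  rw [lieDerivative_dilationP_apply hd, hnear.fderiv_eq, hnear.self_of_nhds,
    dilationP_of_last_eq_zero hv, ← fderiv_apply_const (hd1.fun_add hd2)]
  have e : (fun z => (fderiv ℝ (toLinear a) z (dilationP n z) +
      (toLinear a z).comp (dilationCLM n)) v) = fun z =>
      fderiv ℝ (toLinear a) z (dilationP n z) v + toLinear a z v := by
    funext z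
    rw [_root_.add_apply, ContinuousLinearMap.comp_apply, dilationCLM_apply,
      dilationP_of_last_eq_zero hv]
  have e2 : (fderiv ℝ (toLinear a) y (dilationP n y) +
      (toLinear a y).comp (dilationCLM n)) v =
      fderiv ℝ (toLinear a) y (dilationP n y) v + toLinear a y v := congrFun e y
  rw [e2, e, fderiv_fun_add (hd1.clm_apply (differentiableAt_const _))
    (hA.clm_apply (differentiableAt_const _)), _root_.add_apply, fderiv_apply_const hA,
    fderiv_apply_const hd1, fderiv_clm_apply_apply hDA (differentiable_dilationP n y),
    fderiv_dilationP_apply, dilationP_dilationP, _root_.add_apply]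
  ring

/-! ### The vertical second derivative -/

theorem dilationP_add_smul_vertical (n : ℕ) (y : Coord (n + 2)) (t : ℝ) :
    dilationP n (y + t • partialVec (Fin.last (n + 1))) = dilationP n y := by
  funext α
  by_cases h : α = Fin.last (n + 1) <;> simp [dilationP, partialVec, h]

theorem toSigma_add_smul_vertical (n : ℕ) (ε H : ℝ) (y : Coord (n + 2)) (t : ℝ) :
    toSigma n ε H (y + t • partialVec (Fin.last (n + 1))) = toSigma n ε H y := by
  funext α
  simp only [toSigma, normP, dilationP_add_smul_vertical]
  by_cases h : α = Fin.last (n + 1) <;> simp [partialVec, h]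

theorem extendedFrame_tangent (n : ℕ) (ε H : ℝ) (e : Fin n → Coord (n + 2) → Coord (n + 2))
    (y : Coord (n + 2)) (μ : Fin n) :
    extendedFrame n ε H e y μ.castSucc.castSucc = e μ (toSigma n ε H y) := by
  rw [extendedFrame, Fin.snoc_castSucc, Fin.snoc_castSucc]

theorem extendedFrame_normal (n : ℕ) (ε H : ℝ) (e : Fin n → Coord (n + 2) → Coord (n + 2))
    (y : Coord (n + 2)) :
    extendedFrame n ε H e y (Fin.last n).castSucc = (normP n ε y)⁻¹ • dilationP n y := by
  rw [extendedFrame, Fin.snoc_castSucc, Fin.snoc_last]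

theorem extendedFrame_vertical (n : ℕ) (ε H : ℝ) (e : Fin n → Coord (n + 2) → Coord (n + 2))
    (y : Coord (n + 2)) :
    extendedFrame n ε H e y (Fin.last (n + 1)) = partialVec (Fin.last (n + 1)) := by
  rw [extendedFrame, Fin.snoc_last]

theorem partialLast_congr {n : ℕ} {h k : Coord (n + 2) → ℝ} {y : Coord (n + 2)}
    (hk : ∀ t : ℝ, h (y + t • partialVec (Fin.last (n + 1))) =
      k (y + t • partialVec (Fin.last (n + 1)))) : partialLast n h y = partialLast n k y := by
  simp only [partialLast, lineDeriv, hk]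

/-- The extended frame is constant on vertical lines, and `partialLast` sees only such a line, so
both derivatives fall on the form. -/
theorem partialLast_partialLast_frameComponent {n : ℕ} {ε H : ℝ}
    (e : Fin n → Coord (n + 2) → Coord (n + 2)) {a : Form (n + 2) 1} {y : Coord (n + 2)}
    (ha : ContDiffAt ℝ ∞ (toLinear a) y) (μ : Fin n) :
    partialLast n (partialLast n (frameComponent n ε H e a μ.castSucc.castSucc)) y =
      fderiv ℝ (fderiv ℝ (toLinear a)) y (partialVec (Fin.last (n + 1)))
        (partialVec (Fin.last (n + 1))) (e μ (toSigma n ε H y)) := by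
  have h1 : partialLast n (partialLast n (frameComponent n ε H e a μ.castSucc.castSucc)) y =
      partialLast n (partialLast n (fun z => toLinear a z (e μ (toSigma n ε H y)))) y := by
    refine partialLast_congr fun t => partialLast_congr fun s => ?_
    rw [frameComponent, extendedFrame_tangent, toSigma_add_smul_vertical,
      toSigma_add_smul_vertical, toLinear_apply]
  have hDA : DifferentiableAt ℝ (fderiv ℝ (toLinear a)) y :=
    (ha.fderiv_right (m := ∞) (by simp)).differentiableAt (by simp)
  have h2 : partialLast n (fun z => toLinear a z (e μ (toSigma n ε H y))) =ᶠ[nhds y]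
      fun z => fderiv ℝ (toLinear a) z (partialVec (Fin.last (n + 1)))
        (e μ (toSigma n ε H y)) := by
    filter_upwards [(ha.of_le (m := 1) (by exact_mod_cast le_top)).eventually (by simp)] with z hz
    have hz' : DifferentiableAt ℝ (toLinear a) z := hz.differentiableAt (by simp)
    rw [partialLast, (hz'.clm_apply (differentiableAt_const _)).lineDeriv_eq_fderiv,
      fderiv_apply_const hz']
  rw [h1, partialLast, h2.lineDeriv_eq]
  rw [DifferentiableAt.lineDeriv_eq_fderiv
    ((hDA.clm_apply (differentiableAt_const _)).clm_apply (differentiableAt_const _)),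
    fderiv_apply_apply_const hDA]

namespace IsLocalParametrization

variable {n : ℕ} {ε H : ℝ} {U : Set (Coord n)} {φ : Coord n → Coord (n + 2)}

theorem normP_eq (hφ : IsLocalParametrization n ε H U φ) {u : Coord n} (hu : u ∈ U)
    (hε : ε = 1 ∨ ε = -1) (hH : 0 < H) : normP n ε (φ u) = H⁻¹ := by
  rw [normP, eta_eq, hφ.etaForm_dilationP_dilationP hu, abs_div, abs_neg,
    show |ε| = 1 by rcases hε with rfl | rfl <;> simp, abs_of_pos (by positivity), one_div,
    Real.sqrt_inv, Real.sqrt_sq hH.le]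

theorem toSigma_eq (hφ : IsLocalParametrization n ε H U φ) {u : Coord n} (hu : u ∈ U)
    (hε : ε = 1 ∨ ε = -1) (hH : 0 < H) : toSigma n ε H (φ u) = φ u := by
  funext α
  rw [toSigma, hφ.normP_eq hu hε hH]
  split_ifs with h
  · subst h
    exact (eq_inv_of_mul_eq_one_right (hφ.mapsTo hu).2).symm
  · field_simp

/-- In the expansion of a tangent vector in the full frame, the last coordinate kills the vertical
coefficient and pairing with D_P kills the normal one. Positive orientation makes the frame matrix
invertible. -/
theorem sum_coframe (hφ : IsLocalParametrization n ε H U φ) {u : Coord n} (hu : u ∈ U)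
    (hε : ε = 1 ∨ ε = -1) (hH : 0 < H) {V : Set (Coord (n + 2))}
    {e : Fin n → Coord (n + 2) → Coord (n + 2)} (he : IsOrthonormalFrame n ε H V e)
    (hV : φ u ∈ V) (w : Coord n) :
    ∑ μ : Fin n, coframe n ε H e μ.castSucc.castSucc (φ u) (fun _ => fderiv ℝ φ u w) •
      e μ (φ u) = fderiv ℝ φ u w := by
  set v := fderiv ℝ φ u w with hv
  set M := Matrix.of (extendedFrame n ε H e (φ u)) with hM
  set c := Matrix.vecMul v M⁻¹ with hc
  have hdet : IsUnit M.det := (he.oriented _ hV).ne'.isUnit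
  have hcM : Matrix.vecMul c M = v := by
    rw [hc, Matrix.vecMul_vecMul, Matrix.nonsing_inv_mul _ hdet, Matrix.vecMul_one]
  have hsum : v = ∑ μ : Fin n, c μ.castSucc.castSucc • e μ (φ u) +
      c (Fin.last n).castSucc • (H • dilationP n (φ u)) +
      c (Fin.last (n + 1)) • partialVec (Fin.last (n + 1)) := by
    rw [← hcM]
    have : Matrix.vecMul c M = ∑ α, c α • extendedFrame n ε H e (φ u) α := by
      funext j
      simp [Matrix.vecMul, dotProduct, hM]
    rw [this, Fin.sum_univ_castSucc, Fin.sum_univ_castSucc, extendedFrame_vertical,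
      extendedFrame_normal, hφ.normP_eq hu hε hH, inv_inv]
    simp only [extendedFrame_tangent, hφ.toSigma_eq hu hε hH]
  have hl : c (Fin.last (n + 1)) = 0 := by
    have h := congrFun hsum (Fin.last (n + 1))
    rw [hv, hφ.fderiv_last hu] at h
    simp only [Pi.add_apply, Finset.sum_apply, Pi.smul_apply, (he.tangent _ hV _).2,
      dilationP_last, smul_eq_mul, mul_zero, Finset.sum_const_zero, zero_add, partialVec,
      Pi.single_eq_same, mul_one] at h
    exact h.symm
  rw [hl, zero_smul, add_zero] at hsum
  have hn : c (Fin.last n).castSucc = 0 := by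
    have h := congrArg (etaForm n ε (dilationP n (φ u))) hsum
    have ht : ∀ μ, etaForm n ε (dilationP n (φ u)) (e μ (φ u)) = 0 := by
      intro μ
      have h1 := he.tangent _ hV μ
      rw [dilationP_eq_sub, map_sub, map_smul, _root_.sub_apply, _root_.smul_apply,
        ← eta_eq n ε (φ u), h1.1, etaForm_comm, etaForm_partialVec, h1.2]
      simp
    rw [hv, hφ.etaForm_dilationP_fderiv hu] at h
    simp only [map_add, map_sum, map_smul, ht, hφ.etaForm_dilationP_dilationP hu, smul_eq_mul,
      mul_zero, Finset.sum_const_zero, zero_add] at h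
    have hε0 : ε ≠ 0 := by rcases hε with rfl | rfl <;> norm_num
    rcases mul_eq_zero.1 h.symm with h | h
    · exact h
    · exact absurd h (mul_ne_zero hH.ne' (div_ne_zero (neg_ne_zero.2 hε0) (by positivity)))
  rw [hn, zero_smul, add_zero] at hsum
  exact hsum.symm

/-- On tangent vectors the term is independent of the frame, by linearity and `sum_coframe`. -/
theorem secondVerticalTerm_apply (hφ : IsLocalParametrization n ε H U φ) {u : Coord n}
    (hu : u ∈ U) (hε : ε = 1 ∨ ε = -1) (hH : 0 < H) {V : Set (Coord (n + 2))}
    {e : Fin n → Coord (n + 2) → Coord (n + 2)} (he : IsOrthonormalFrame n ε H V e)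
    (hV : φ u ∈ V) {a : Form (n + 2) 1} (ha : ContDiffAt ℝ ∞ (toLinear a) (φ u)) (w : Coord n) :
    secondVerticalTerm n ε H e a (φ u) (fun _ => fderiv ℝ φ u w) =
      fderiv ℝ (fderiv ℝ (toLinear a)) (φ u) (partialVec (Fin.last (n + 1)))
        (partialVec (Fin.last (n + 1))) (fderiv ℝ φ u w) := by
  conv_rhs => rw [← hφ.sum_coframe hu hε hH he hV w]
  rw [secondVerticalTerm, ContinuousAlternatingMap.sum_apply, map_sum]
  refine Finset.sum_congr rfl fun μ _ => ?_
  rw [ContinuousAlternatingMap.smul_apply, partialLast_partialLast_frameComponent e ha,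
    hφ.toSigma_eq hu hε hH, map_smul, smul_eq_mul, smul_eq_mul, mul_comm]

end IsLocalParametrization

/-! ### The intrinsic Laplace-de Rham operator of `Σ_n` -/

theorem differentiableAt_flip {E F G : Type*} [NormedAddCommGroup E] [NormedSpace ℝ E]
    [NormedAddCommGroup F] [NormedSpace ℝ F] [NormedAddCommGroup G] [NormedSpace ℝ G]
    {a : E → F →L[ℝ] F →L[ℝ] G} {y : E} (h : DifferentiableAt ℝ a y) :
    DifferentiableAt ℝ (fun z => (a z).flip) y := by
  let L := (ContinuousLinearMap.flipₗᵢ ℝ F F G).toContinuousLinearEquiv.toContinuousLinearMap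
  have hL : Differentiable ℝ (fun B : F →L[ℝ] F →L[ℝ] G => L B) := L.differentiable
  exact DifferentiableAt.comp (𝕜 := ℝ) (F := F →L[ℝ] F →L[ℝ] G) (G := F →L[ℝ] F →L[ℝ] G) y
    (hL (a y)) h

/-- The bilinear form `(v, w) ↦ da(v, w)`. -/
def curvatureForm {N : ℕ} (a : Form N 1) (y : Coord N) : Coord N →L[ℝ] Coord N →L[ℝ] ℝ :=
  fderiv ℝ (toLinear a) y - (fderiv ℝ (toLinear a) y).flip

theorem curvatureForm_apply {N : ℕ} (a : Form N 1) (y v w : Coord N) :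
    curvatureForm a y v w = fderiv ℝ (toLinear a) y v w - fderiv ℝ (toLinear a) y w v := rfl

theorem differentiableAt_curvatureForm {N : ℕ} {a : Form N 1} {y : Coord N}
    (h : DifferentiableAt ℝ (fderiv ℝ (toLinear a)) y) :
    DifferentiableAt ℝ (curvatureForm a) y :=
  DifferentiableAt.fun_sub (𝕜 := ℝ) (F := Coord N →L[ℝ] Coord N →L[ℝ] ℝ) h
    (differentiableAt_flip h)

theorem fderiv_curvatureForm_apply {N : ℕ} {a : Form N 1} {y : Coord N}
    (h : DifferentiableAt ℝ (fderiv ℝ (toLinear a)) y) (v w w' : Coord N) :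
    fderiv ℝ (curvatureForm a) y v w w' =
      fderiv ℝ (fderiv ℝ (toLinear a)) y v w w' - fderiv ℝ (fderiv ℝ (toLinear a)) y v w' w := by
  rw [← fderiv_apply_apply_const (differentiableAt_curvatureForm h)]
  simp only [curvatureForm_apply]
  have hd : ∀ v w, DifferentiableAt ℝ (fun z => fderiv ℝ (toLinear a) z v w) y := fun v w =>
    (h.clm_apply (differentiableAt_const v)).clm_apply (differentiableAt_const w)
  rw [fderiv_fun_sub (hd _ _) (hd _ _), _root_.sub_apply, fderiv_apply_apply_const h,
    fderiv_apply_apply_const h]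

/-- The tangential divergence of a one-form, as a function on the ambient space. -/
def tangentialDivergence (n : ℕ) (ε H : ℝ) (a : Form (n + 2) 1) (y : Coord (n + 2)) : ℝ :=
  ∑ α, etaDiag n ε α * fderiv ℝ (toLinear a) y (partialVec α) (partialVec α) +
    ε * H ^ 2 * fderiv ℝ (toLinear a) y (dilationP n y) (dilationP n y) -
    ε * fderiv ℝ (toLinear a) y (partialVec (Fin.last (n + 1))) (partialVec (Fin.last (n + 1))) +
    n * ε * H ^ 2 * toLinear a y (dilationP n y)

/-- For v parallel to P the derivative of D_P along v is v, which accounts for the first-order and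
zeroth-order terms. -/
theorem hasFDerivAt_tangentialDivergence {n : ℕ} {ε H : ℝ} {a : Form (n + 2) 1}
    {y : Coord (n + 2)} (ha : ContDiffAt ℝ ∞ (toLinear a) y) :
    DifferentiableAt ℝ (tangentialDivergence n ε H a) y ∧
      ∀ v, v (Fin.last (n + 1)) = 0 → fderiv ℝ (tangentialDivergence n ε H a) y v =
        ∑ α, etaDiag n ε α *
          fderiv ℝ (fderiv ℝ (toLinear a)) y v (partialVec α) (partialVec α) +
        ε * H ^ 2 * (fderiv ℝ (fderiv ℝ (toLinear a)) y v (dilationP n y) (dilationP n y) +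
          fderiv ℝ (toLinear a) y v (dilationP n y) +
          fderiv ℝ (toLinear a) y (dilationP n y) v) -
        ε * fderiv ℝ (fderiv ℝ (toLinear a)) y v (partialVec (Fin.last (n + 1)))
          (partialVec (Fin.last (n + 1))) +
        n * ε * H ^ 2 * (fderiv ℝ (toLinear a) y v (dilationP n y) + toLinear a y v) := by
  have hDA : DifferentiableAt ℝ (fderiv ℝ (toLinear a)) y :=
    (ha.fderiv_right (m := ∞) (by simp)).differentiableAt (by simp)
  have hA : DifferentiableAt ℝ (toLinear a) y := ha.differentiableAt (by simp)
  have hc : ∀ v w, DifferentiableAt ℝ (fun z => fderiv ℝ (toLinear a) z v w) y := fun v w =>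
    (hDA.clm_apply (differentiableAt_const v)).clm_apply (differentiableAt_const w)
  have hP := differentiable_dilationP n y
  have h1 : DifferentiableAt ℝ (fun y => ∑ α, etaDiag n ε α *
      fderiv ℝ (toLinear a) y (partialVec α) (partialVec α)) y :=
    DifferentiableAt.fun_sum fun α _ => (hc _ _).const_mul _
  have h2' : DifferentiableAt ℝ (fun y => fderiv ℝ (toLinear a) y (dilationP n y)) y :=
    hDA.clm_apply hP
  have h2 : DifferentiableAt ℝ
      (fun y => fderiv ℝ (toLinear a) y (dilationP n y) (dilationP n y)) y := h2'.clm_apply hP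
  have h4 : DifferentiableAt ℝ (fun y => toLinear a y (dilationP n y)) y := hA.clm_apply hP
  have h12 := h1.fun_add (h2.const_mul (ε * H ^ 2))
  have h123 := h12.fun_sub ((hc (partialVec (Fin.last (n + 1)))
    (partialVec (Fin.last (n + 1)))).const_mul ε)
  refine ⟨h123.fun_add (h4.const_mul (n * ε * H ^ 2)), fun v hv => ?_⟩
  unfold tangentialDivergence
  rw [fderiv_fun_add h123 (h4.const_mul _), fderiv_fun_sub h12 ((hc _ _).const_mul _),
    fderiv_fun_add h1 (h2.const_mul _), fderiv_const_mul h2, fderiv_const_mul h4,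
    fderiv_const_mul (hc _ _), fderiv_fun_sum fun α _ => (hc _ _).const_mul _]
  simp only [fderiv_const_mul (hc _ _), _root_.add_apply, _root_.sub_apply, _root_.smul_apply,
    _root_.sum_apply, smul_eq_mul, fderiv_apply_apply_const hDA]
  rw [fderiv_clm_apply_apply h2' hP, fderiv_clm_apply_apply hDA hP, fderiv_clm_apply_apply hA hP,
    fderiv_dilationP_apply, dilationP_of_last_eq_zero hv, _root_.add_apply]

theorem sum_inducedMetric_sharpBasis {n : ℕ} {ε : ℝ} {φ : Coord n → Coord (n + 2)} {u : Coord n}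
    (hdet : (inducedMetric n ε φ u).det ≠ 0) (j : Fin n) :
    ∑ k, inducedMetric n ε φ u j k • sharpBasis (inducedMetric n ε φ u) k = partialVec j := by
  have h := Matrix.mul_nonsing_inv (inducedMetric n ε φ u) hdet.isUnit
  funext l
  have := congrFun (congrFun h j) l
  rw [Matrix.mul_apply] at this
  simp only [Finset.sum_apply, Pi.smul_apply, sharpBasis, smul_eq_mul]
  rw [this]
  simp [partialVec, Matrix.one_apply, Pi.single_apply, eq_comm]

namespace IsLocalParametrization

variable {n : ℕ} {ε H : ℝ} {U : Set (Coord n)} {φ : Coord n → Coord (n + 2)}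
  (hφ : IsLocalParametrization n ε H U φ) {u : Coord n} (hu : u ∈ U) (hε : ε = 1 ∨ ε = -1)
include hφ hu hε

omit hε in
theorem fderiv_comp_apply {F : Type*} [NormedAddCommGroup F] [NormedSpace ℝ F]
    {f : Coord (n + 2) → F} (hf : DifferentiableAt ℝ f (φ u)) (v : Coord n) :
    fderiv ℝ (fun z => f (φ z)) u v = fderiv ℝ f (φ u) (fderiv ℝ φ u v) := by
  have h := hf.hasFDerivAt.comp u (hφ.differentiableAt hu).hasFDerivAt
  exact congrArg (fun L : Coord n →L[ℝ] F => L v) h.fderiv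

theorem differentiableAt_density_raisedVec (i : Fin n) : DifferentiableAt ℝ
    (fun z => √|(inducedMetric n ε φ z).det| • raisedVec n ε φ i z) u := by
  obtain ⟨D, hD, -⟩ := hφ.hasFDerivAt_density hu hε
  exact hD.differentiableAt.fun_smul (hφ.differentiableAt_raisedVec hu hε i)

theorem density_ne_zero : √|(inducedMetric n ε φ u).det| ≠ 0 :=
  (Real.sqrt_pos.2 (abs_pos.2 (hφ.det_inducedMetric_ne_zero hu hε))).ne'

/-- Product rule for A(|g|^{1/2} E^i): differentiating A gives the tangential trace, differentiating
the vector gives the mean curvature. -/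
theorem codiff_pullback_apply {a : Form (n + 2) 1} (ha : ContDiffAt ℝ ∞ (toLinear a) (φ u)) :
    codiff (inducedMetric n ε φ) (pullback φ a) u Fin.elim0 =
      -tangentialDivergence n ε H a (φ u) := by
  have hA : DifferentiableAt ℝ (toLinear a) (φ u) := ha.differentiableAt (by simp)
  have hd : ∀ I : Fin 1 → Fin n, densitized (inducedMetric n ε φ) (pullback φ a) I =
      fun z => toLinear a (φ z)
        (√|(inducedMetric n ε φ z).det| • raisedVec n ε φ (I 0) z) := by
    intro I
    funext z
    rw [densitized, map_smul, smul_eq_mul, form_one_apply]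
    rfl
  have hW := fun i => hφ.differentiableAt_density_raisedVec hu hε i
  have hAφ : DifferentiableAt ℝ (fun z => toLinear a (φ z)) u :=
    hA.comp u (hφ.differentiableAt hu)
  have h := codiff_apply_sharp (hφ.det_inducedMetric_ne_zero hu hε) (inducedMetric_isSymm u)
    (fun I => by rw [hd]; exact hAφ.clm_apply (hW _))
    (α := pullback φ a) Fin.elim0
  rw [show (fun k => sharpBasis (inducedMetric n ε φ u) (Fin.elim0 k)) =
    (Fin.elim0 : Fin 0 → Coord n) from funext fun k => k.elim0] at h
  rw [h]
  simp only [hd, Fin.cons_zero]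
  simp only [fderiv_clm_apply_apply hAφ (hW _), hφ.fderiv_comp_apply hu hA]
  simp only [Finset.sum_add_distrib, ← map_sum,
    hφ.sum_fderiv_density_raisedVec hu hε, map_smul, smul_eq_mul, ← Finset.mul_sum]
  rw [hφ.sum_tangent_trace hu hε, tangentialDivergence]
  have := hφ.density_ne_zero hu hε
  field_simp

/-- The tangential trace of the covariant derivative of `da`. -/
theorem sum_fderiv_curvatureForm (a : Form (n + 2) 1) (w : Coord (n + 2)) :
    ∑ i, fderiv ℝ (curvatureForm a) (φ u) (fderiv ℝ φ u (partialVec i))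
        (raisedVec n ε φ i u) w =
      ∑ α, etaDiag n ε α *
        fderiv ℝ (curvatureForm a) (φ u) (partialVec α) (partialVec α) w +
        ε * H ^ 2 * fderiv ℝ (curvatureForm a) (φ u) (dilationP n (φ u)) (dilationP n (φ u)) w -
        ε * fderiv ℝ (curvatureForm a) (φ u) (partialVec (Fin.last (n + 1)))
          (partialVec (Fin.last (n + 1))) w :=
  hφ.sum_tangent_trace hu hε ((ContinuousLinearMap.compL ℝ (Coord (n + 2))
    (Coord (n + 2) →L[ℝ] ℝ) ℝ (ContinuousLinearMap.apply ℝ ℝ w)).comp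
      (fderiv ℝ (curvatureForm a) (φ u)))

/-- The product rule has three terms: the derivative of da, the mean curvature in the first slot,
and the derivative of E^k in the second. The identity is first obtained with k raised; lowering it
by g_{jk} is what makes `sum_alternating_fderiv_raisedVec` applicable to the third term. -/
theorem codiff_extDeriv_pullback_apply {a : Form (n + 2) 1}
    (ha : ∀ z ∈ U, ContDiffAt ℝ ∞ a (φ z)) (j : Fin n) :
    codiff (inducedMetric n ε φ) (extDeriv (pullback φ a)) u (fun _ => partialVec j) =
      -(∑ i, fderiv ℝ (curvatureForm a) (φ u) (fderiv ℝ φ u (partialVec i))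
          (raisedVec n ε φ i u) (fderiv ℝ φ u (partialVec j)) +
        n * ε * H ^ 2 * curvatureForm a (φ u) (dilationP n (φ u)) (fderiv ℝ φ u (partialVec j)) +
        ε * H ^ 2 *
          curvatureForm a (φ u) (fderiv ℝ φ u (partialVec j)) (dilationP n (φ u))) := by
  have hAu : ContDiffAt ℝ ∞ (toLinear a) (φ u) := contDiffAt_toLinear (ha u hu)
  have hDA : DifferentiableAt ℝ (fderiv ℝ (toLinear a)) (φ u) :=
    (hAu.fderiv_right (m := ∞) (by simp)).differentiableAt (by simp)
  have hf : DifferentiableAt ℝ (fun z => curvatureForm a (φ z)) u :=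
    DifferentiableAt.comp (G := Coord (n + 2) →L[ℝ] Coord (n + 2) →L[ℝ] ℝ)
      (g := curvatureForm a) u (differentiableAt_curvatureForm hDA) (hφ.differentiableAt hu)
  have hd : ∀ I : Fin 2 → Fin n, densitized (inducedMetric n ε φ) (extDeriv (pullback φ a)) I
      =ᶠ[nhds u] fun z => curvatureForm a (φ z)
        (√|(inducedMetric n ε φ z).det| • raisedVec n ε φ (I 0) z) (raisedVec n ε φ (I 1) z) := by
    intro I
    filter_upwards [hφ.eventually_mem hu] with z hz
    have e := extDeriv_pullback ((ha z hz).differentiableAt (by simp)) (hφ.contDiffAt hz)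
      minSmoothness_two_le_infty
    have e' : extDeriv (pullback φ a) z =
      (extDeriv a (φ z)).compContinuousLinearMap (fderiv ℝ φ z) := e
    rw [densitized, e', map_smul, _root_.smul_apply, smul_eq_mul]
    congr 1
    exact extDeriv_one_apply a (φ z) _
  have hW := fun i => hφ.differentiableAt_density_raisedVec hu hε i
  have hE := fun i => hφ.differentiableAt_raisedVec hu hε i
  have h1 : ∀ k, codiff (inducedMetric n ε φ) (extDeriv (pullback φ a)) u
      (fun _ => sharpBasis (inducedMetric n ε φ u) k) =
      -(∑ i, fderiv ℝ (curvatureForm a) (φ u) (fderiv ℝ φ u (partialVec i))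
          (raisedVec n ε φ i u) (raisedVec n ε φ k u) +
        n * ε * H ^ 2 * curvatureForm a (φ u) (dilationP n (φ u)) (raisedVec n ε φ k u) +
        ∑ i, curvatureForm a (φ u) (raisedVec n ε φ i u)
          (fderiv ℝ (raisedVec n ε φ k) u (partialVec i))) := by
    intro k
    have h := codiff_apply_sharp (hφ.det_inducedMetric_ne_zero hu hε) (inducedMetric_isSymm u)
      (fun I => ((hf.clm_apply (hW _)).clm_apply (hE _)).congr_of_eventuallyEq (hd I))
      (α := extDeriv (pullback φ a)) (fun _ => k)
    rw [h]
    have e : ∀ i, fderiv ℝ (densitized (inducedMetric n ε φ) (extDeriv (pullback φ a))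
        (Fin.cons (α := fun _ => Fin n) i fun _ => k)) u (partialVec i) =
        √|(inducedMetric n ε φ u).det| *
          fderiv ℝ (curvatureForm a) (φ u) (fderiv ℝ φ u (partialVec i))
            (raisedVec n ε φ i u) (raisedVec n ε φ k u) +
        curvatureForm a (φ u) (fderiv ℝ (fun z => √|(inducedMetric n ε φ z).det| •
          raisedVec n ε φ i z) u (partialVec i)) (raisedVec n ε φ k u) +
        √|(inducedMetric n ε φ u).det| * curvatureForm a (φ u) (raisedVec n ε φ i u)
          (fderiv ℝ (raisedVec n ε φ k) u (partialVec i)) := by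
      intro i
      rw [(hd _).fderiv_eq]
      simp only [Fin.cons_zero, Fin.cons_one]
      rw [fderiv_clm_apply_apply (hf.clm_apply (hW _)) (hE _),
        fderiv_clm_apply_apply hf (hW _),
        hφ.fderiv_comp_apply hu (differentiableAt_curvatureForm hDA)]
      simp only [map_smul, _root_.add_apply, _root_.smul_apply, smul_eq_mul]
    simp only [e, Finset.sum_add_distrib, ← Finset.mul_sum]
    have e2 := congrArg (fun W => curvatureForm a (φ u) W (raisedVec n ε φ k u))
      (hφ.sum_fderiv_density_raisedVec hu hε)
    simp only [map_sum, _root_.sum_apply, map_smul, _root_.smul_apply, smul_eq_mul] at e2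
    rw [e2]
    have := hφ.density_ne_zero hu hε
    field_simp
  have h2 : codiff (inducedMetric n ε φ) (extDeriv (pullback φ a)) u (fun _ => partialVec j) =
      ∑ k, inducedMetric n ε φ u j k *
        codiff (inducedMetric n ε φ) (extDeriv (pullback φ a)) u
          (fun _ => sharpBasis (inducedMetric n ε φ u) k) := by
    simp only [← toLinear_apply]
    conv_lhs => rw [← sum_inducedMetric_sharpBasis (hφ.det_inducedMetric_ne_zero hu hε) j, map_sum]
    simp only [map_smul, smul_eq_mul]
  rw [h2]
  simp only [h1]
  have h3 := hφ.sum_alternating_fderiv_raisedVec hu hε (curvatureForm a (φ u))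
    (fun v w => by rw [curvatureForm_apply, curvatureForm_apply]; ring) j
  rw [Finset.sum_comm] at h3
  rw [← h3, ← hφ.sum_inducedMetric_raisedVec hu hε j]
  simp only [map_sum, map_smul, smul_eq_mul, mul_neg, mul_add, Finset.sum_add_distrib,
    Finset.sum_neg_distrib, Finset.mul_sum]
  congr 1
  congr 1
  congr 1
  · rw [Finset.sum_comm]
  · exact Finset.sum_congr rfl fun k _ => by ring

theorem laplaceDeRham_induced_apply {a : Form (n + 2) 1}
    (ha : ∀ z ∈ U, ContDiffAt ℝ ∞ a (φ z)) (j : Fin n) :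
    laplaceDeRham (inducedMetric n ε φ) (pullback φ a) u (fun _ => partialVec j) =
      fderiv ℝ (tangentialDivergence n ε H a) (φ u) (fderiv ℝ φ u (partialVec j)) +
      (∑ i, fderiv ℝ (curvatureForm a) (φ u) (fderiv ℝ φ u (partialVec i))
          (raisedVec n ε φ i u) (fderiv ℝ φ u (partialVec j)) +
        n * ε * H ^ 2 * curvatureForm a (φ u) (dilationP n (φ u)) (fderiv ℝ φ u (partialVec j)) +
        ε * H ^ 2 *
          curvatureForm a (φ u) (fderiv ℝ φ u (partialVec j)) (dilationP n (φ u))) := by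
  have hAu : ContDiffAt ℝ ∞ (toLinear a) (φ u) := contDiffAt_toLinear (ha u hu)
  have hδ : (fun z => codiff (inducedMetric n ε φ) (pullback φ a) z Fin.elim0) =ᶠ[nhds u]
      fun z => -tangentialDivergence n ε H a (φ z) := by
    filter_upwards [hφ.eventually_mem hu] with z hz
    exact hφ.codiff_pullback_apply hz hε (contDiffAt_toLinear (ha z hz))
  rw [laplaceDeRham, ContinuousAlternatingMap.neg_apply, ContinuousAlternatingMap.add_apply,
    extDeriv_zeroForm_apply, hφ.codiff_extDeriv_pullback_apply hu hε ha, hδ.fderiv_eq,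
    fderiv_fun_neg, _root_.neg_apply,
    hφ.fderiv_comp_apply hu (hasFDerivAt_tangentialDivergence hAu).1]
  ring

end IsLocalParametrization

theorem pullback_one_apply {N M : ℕ} (φ : Coord M → Coord N) (α : Form N 1) (u v : Coord M) :
    pullback φ α u (fun _ => v) = α (φ u) (fun _ => fderiv ℝ φ u v) := rfl

end LaplaceRestriction

end

/-! ### Comparison of the ambient and intrinsic operators. -/

open LaplaceRestriction

theorem mainTheorem7 (n : ℕ) (hn : 1 ≤ n) (ε H : ℝ) (hε : ε = 1 ∨ ε = -1) (hH : 0 < H)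
    (V : Set (LaplaceRestriction.Coord (n + 2)))
    (e : Fin n → LaplaceRestriction.Coord (n + 2) → LaplaceRestriction.Coord (n + 2))
    (he : LaplaceRestriction.IsOrthonormalFrame n ε H V e)
    (Ω : Set (LaplaceRestriction.Coord (n + 2))) (hΩ : IsOpen Ω)
    (a : LaplaceRestriction.Form (n + 2) 1) (ha : ContDiffOn ℝ ∞ a Ω)
    (U : Set (LaplaceRestriction.Coord n))
    (φ : LaplaceRestriction.Coord n → LaplaceRestriction.Coord (n + 2))
    (hφ : LaplaceRestriction.IsLocalParametrization n ε H U φ)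
    (hφV : Set.MapsTo φ U (V ∩ Ω)) :
    ∀ u ∈ U,
      LaplaceRestriction.pullback φ
          (LaplaceRestriction.laplaceDeRham (LaplaceRestriction.ambientMetric n ε) a) u =
        LaplaceRestriction.laplaceDeRham (LaplaceRestriction.inducedMetric n ε φ)
            (LaplaceRestriction.pullback φ a) u +
          LaplaceRestriction.pullback φ
            (fun y =>
              ε • LaplaceRestriction.secondVerticalTerm n ε H e a y -
                (ε * H ^ 2) •
                  (LaplaceRestriction.lieDerivative (LaplaceRestriction.dilationP n)
                      (LaplaceRestriction.lieDerivative (LaplaceRestriction.dilationP n) a) y +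
                    ((n : ℝ) - 3) •
                      LaplaceRestriction.lieDerivative (LaplaceRestriction.dilationP n) a y +
                    (2 : ℝ) •
                      extDeriv
                        (LaplaceRestriction.interior (LaplaceRestriction.dilationP n) a) y)) u := by
  intro u hu
  have haΩ : ∀ z ∈ U, ContDiffAt ℝ ∞ a (φ z) := fun z hz =>
    ha.contDiffAt (hΩ.mem_nhds (hφV hz).2)
  have hAu : ContDiffAt ℝ ∞ (toLinear a) (φ u) := contDiffAt_toLinear (haΩ u hu)
  have hDA : DifferentiableAt ℝ (fderiv ℝ (toLinear a)) (φ u) :=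
    (hAu.fderiv_right (m := ∞) (by simp)).differentiableAt (by simp)
  have hA : DifferentiableAt ℝ (toLinear a) (φ u) := hAu.differentiableAt (by simp)
  refine form_one_ext fun j => ?_
  have hl := hφ.fderiv_last hu (partialVec j)
  rw [ContinuousAlternatingMap.add_apply, pullback_one_apply, pullback_one_apply,
    laplaceDeRham_ambient_apply n hε (haΩ u hu), hφ.laplaceDeRham_induced_apply hu hε haΩ,
    (hasFDerivAt_tangentialDivergence hAu).2 _ hl, hφ.sum_fderiv_curvatureForm hu hε]
  simp only [ContinuousAlternatingMap.sub_apply, ContinuousAlternatingMap.smul_apply,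
    ContinuousAlternatingMap.add_apply, smul_eq_mul,
    hφ.secondVerticalTerm_apply hu hε hH he (hφV hu).1 hAu,
    lieDerivative_lieDerivative_dilationP_apply hAu hl, lieDerivative_dilationP_apply hA,
    extDeriv_interior_dilationP_apply hA, dilationP_of_last_eq_zero hl,
    fderiv_curvatureForm_apply hDA, curvatureForm_apply]
  -- Once second derivatives commute, the mixed terms cancel and the rest is linear algebra. The
  -- coefficient of A(E_j) agrees because 1 + (n - 3) + 2 = n, that of its derivative along D_P
  -- because 3 + (n - 3) = n.
  have hD2 : ∀ v, fderiv ℝ (fderiv ℝ (toLinear a)) (φ u) (fderiv ℝ φ u (partialVec j)) v =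
      fderiv ℝ (fderiv ℝ (toLinear a)) (φ u) v (fderiv ℝ φ u (partialVec j)) :=
    fun v => hAu.isSymmSndFDerivAt minSmoothness_two_le_infty _ v
  simp only [hD2, mul_sub, Finset.sum_sub_distrib]
  ring
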